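/- All manifolds, bundles, sections and functions are $C^\infty$; for a vector bundle $W\to Q$, $\Gamma(W)$ is its space of sections. Let $\tau_E:E\to Q$ be a vector bundle over a manifold with a skew-symmetric algebroid structure, that is, a skew-symmetric $\mathbb R$-bilinear bracket $[\cdot,\cdot]$ on $\Gamma(E)$ and a vector bundle morphism $\rho:E\to TQ$ with $[\sigma,f\gamma]=f[\sigma,\gamma]+\rho(\sigma)(f)\,\gamma$ for $\sigma,\gamma\in\Gamma(E)$, $f\in C^\infty(Q)$ (for instance a Lie algebroid). For $\beta\in\Gamma(E^*)$ put $d^E\beta(\sigma,\gamma)=\rho(\sigma)(\beta(\gamma))-\rho(\gamma)(\beta(\sigma))-\beta([\sigma,\gamma])$. Let $\phi\in\Gamma(E^*)$ satisfy $d^E\phi=0$ and $\phi(q)\neq0$ for all $q\in Q$. Then $V=\{v\in E:\phi(v)=0\}$ is a vector subbundle, with inclusion $i_V:V\to E$, and the bracket and the anchor restrict to a skew-symmetric algebroid structure on $V$, whose differential is denoted $d^V$. Let $\mu=i_V^*:E^*\to V^*$ be the restriction map and $\tau_{V^*}:V^*\to Q$, $\tau_{E^*}:E^*\to Q$ the projections.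 Let $\mathcal G$ be a (positive definite) bundle metric on $E$ and $\mathcal X=\flat_{\mathcal G}^{-1}\circ\phi\in\Gamma(E)$, normalised so that $\mathcal G(\mathcal X,\mathcal X)=1$, and let $\mathbb V\in C^\infty(Q)$. Define $H:V^*\to\mathbb R$ by $H(\eta_q)=\tfrac12\mathcal G_V^*(\eta_q,\eta_q)+\mathbb V(q)$, where $\mathcal G_V^*$ is the metric on $V^*$ induced by $\mathcal G$; define $h:V^*\to E^*$ by $h(\eta_q)|_{V_q}=\eta_q$ and $h(\eta_q)(\mathcal X(q))=-H(\eta_q)$; and define $F_h:E^*\to\mathbb R$ by $a-h(\mu(a))=F_h(a)\,\phi(\tau_{E^*}(a))$. For $\sigma\in\Gamma(E)$ let $\widehat\sigma:E^*\to\mathbb R$ be the function $a\mapsto a(\sigma(\tau_{E^*}(a)))$. Let $\Pi$ be the bivector on $E^*$ whose bracket $\{F,G\}=\Pi(dF,dG)$ is determined by $\{\widehat\sigma,\widehat\gamma\}=-\widehat{[\sigma,\gamma]}$, $\{f\circ\tau_{E^*},\widehat\sigma\}=\rho(\sigma)(f)\circ\tau_{E^*}$ and $\{f\circ\tau_{E^*},g\circ\tau_{E^*}\}=0$.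 Let $\mathcal H_{F_h}$ be the Hamiltonian vector field of $F_h$ on $E^*$, given by $dG(\mathcal H_{F_h})=\{G,F_h\}$, and let $R_h$ be the vector field on $V^*$ onto which it projects: $R_h\circ\mu=T\mu\circ\mathcal H_{F_h}$. For $\alpha\in\Gamma(V^*)$ let $R_h^\alpha=T\tau_{V^*}\circ R_h\circ\alpha\in\mathfrak X(Q)$, and let $\zeta_H^\alpha\in\Gamma(V)$ be defined by $\beta(\zeta_H^\alpha(q))=\frac{d}{dt}\big|_{t=0}H(\alpha(q)+t\beta)$ for all $q\in Q$, $\beta\in V_q^*$. Then the following statements are equivalent: (i) whenever $c:I\to Q$, with $I\subseteq\mathbb R$ an open interval, is an integral curve of $R_h^\alpha$, the curve $\alpha\circ c:I\to V^*$ is an integral curve of $R_h$; (ii) $\alpha$ satisfies the Hamilton–Jacobi equation $$i_{\zeta_H^\alpha}d^V\alpha+\mu\circ i_{\mathcal X}d^E(h\circ\alpha)=0 .$$ -/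

import Mathlib

open Bundle Module
open scoped Manifold ContDiff Topology

namespace HJ
noncomputable section

variable {B : Type*} [NormedAddCommGroup B] [NormedSpace ℝ B]
  {Q : Type*} [TopologicalSpace Q] [ChartedSpace B Q]
  {F : Type*} [NormedAddCommGroup F] [NormedSpace ℝ F]
  {E : Q → Type*} [TopologicalSpace (TotalSpace F E)] [∀ q, AddCommGroup (E q)]
  [∀ q, Module ℝ (E q)] [∀ q, TopologicalSpace (E q)]
  [FiberBundle F E] [VectorBundle ℝ F E]

/-- The space `Γ(E)` of smooth sections of a vector bundle `E` with typical fibre `F` over a manifold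
`Q` modelled on `B`. -/
abbrev Sec (B : Type*) [NormedAddCommGroup B] [NormedSpace ℝ B]
  {Q : Type*} [TopologicalSpace Q] [ChartedSpace B Q]
  (F : Type*) [NormedAddCommGroup F] [NormedSpace ℝ F]
  (E : Q → Type*) [TopologicalSpace (TotalSpace F E)]
  [∀ q, TopologicalSpace (E q)] [FiberBundle F E] := Cₛ^∞⟮𝓘(ℝ, B); F, E⟯

variable (B F E) in
/-- The space `Γ(E*)` of smooth sections of the dual bundle. -/
abbrev DualSec := Sec B (F →L[ℝ] ℝ) (fun q => E q →L[ℝ] ℝ)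

theorem contMDiffAt_clm {M F₁ F₂ : Type*} [TopologicalSpace M] [ChartedSpace B M]
   [NormedAddCommGroup F₁] [NormedSpace ℝ F₁] [FiniteDimensional ℝ F₁]
   [NormedAddCommGroup F₂] [NormedSpace ℝ F₂] {f : M → F₁ →L[ℝ] F₂} {x : M}
   (h : ∀ v, ContMDiffAt 𝓘(ℝ, B) 𝓘(ℝ, F₂) ∞ (fun m => f m v) x) :
   ContMDiffAt 𝓘(ℝ, B) 𝓘(ℝ, F₁ →L[ℝ] F₂) ∞ f x := by
  let d := finrank ℝ F₁
  have hd : d = finrank ℝ (Fin d → ℝ) := (finrank_fin_fun ℝ).symm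
  let e₁ := ContinuousLinearEquiv.ofFinrankEq hd
  let e₂ := (e₁.arrowCongr (1 : F₂ ≃L[ℝ] F₂)).trans (ContinuousLinearEquiv.piRing (Fin d))
  have h2 : ContMDiffAt 𝓘(ℝ, B) 𝓘(ℝ, Fin d → F₂) ∞ (fun m => e₂ (f m)) x := by
    rw [contMDiffAt_pi_space]
    intro i
    exact h _
  have h3 : f = fun m => e₂.symm (e₂ (f m)) := by
    ext1 m; simp
  rw [h3]
  exact (e₂.symm : (Fin d → F₂) →L[ℝ] (F₁ →L[ℝ] F₂)).contMDiff.contMDiffAt.comp x h2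

/-- A family of linear maps between fibres is smooth at a point if it sends the sections which are
constant in a trivialisation to smooth sections. -/
theorem contMDiffAt_hom [FiniteDimensional ℝ F] [ContMDiffVectorBundle ∞ F E 𝓘(ℝ, B)]
    {F' : Type*} [NormedAddCommGroup F'] [NormedSpace ℝ F']
    {E' : Q → Type*} [TopologicalSpace (TotalSpace F' E')] [∀ q, AddCommGroup (E' q)]
    [∀ q, Module ℝ (E' q)] [∀ q, TopologicalSpace (E' q)]
    [∀ q, IsTopologicalAddGroup (E' q)] [∀ q, ContinuousSMul ℝ (E' q)]
    [FiberBundle F' E'] [VectorBundle ℝ F' E']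
    {α : ∀ q, E q →L[ℝ] E' q} {q₀ : Q}
    (h : ∀ x : F, ContMDiffAt 𝓘(ℝ, B) (𝓘(ℝ, B).prod 𝓘(ℝ, F')) ∞
      (fun q => TotalSpace.mk' F' q (α q ((trivializationAt F E q₀).symmL ℝ q x))) q₀) :
    ContMDiffAt 𝓘(ℝ, B) (𝓘(ℝ, B).prod 𝓘(ℝ, F →L[ℝ] F')) ∞
      (fun q => TotalSpace.mk' (F →L[ℝ] F') (E := fun q => E q →L[ℝ] E' q) q (α q)) q₀ := by
  rw [contMDiffAt_hom_bundle]
  refine ⟨contMDiffAt_id, contMDiffAt_clm fun v => ?_⟩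
  have h1 := h v
  rw [contMDiffAt_section] at h1
  refine h1.congr_of_eventuallyEq ?_
  filter_upwards [(trivializationAt F' E' q₀).open_baseSet.mem_nhds
    (FiberBundle.mem_baseSet_trivializationAt' q₀)] with y hy
  simp [ContinuousLinearMap.inCoordinates, Trivialization.linearMapAt_apply, hy]

variable (B F E) in
/-- A smooth section of the dual bundle without zeros. -/
structure NowhereZero where
  form : DualSec B F E
  ne_zero : ∀ q, form q ≠ 0

namespace NowhereZero
variable (φ : NowhereZero B F E)

/-- The fibre over `q` of the kernel bundle of `φ`. -/
def Ker (q : Q) : Type _ := LinearMap.ker (φ.form q : E q →ₗ[ℝ] ℝ)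

instance (q : Q) : AddCommGroup (φ.Ker q) :=
  inferInstanceAs (AddCommGroup (LinearMap.ker (φ.form q : E q →ₗ[ℝ] ℝ)))
instance (q : Q) : Module ℝ (φ.Ker q) :=
  inferInstanceAs (Module ℝ (LinearMap.ker (φ.form q : E q →ₗ[ℝ] ℝ)))
instance (q : Q) : TopologicalSpace (φ.Ker q) :=
  inferInstanceAs (TopologicalSpace (LinearMap.ker (φ.form q : E q →ₗ[ℝ] ℝ)))

/-- The inclusion of the kernel bundle. -/
def incl (q : Q) : φ.Ker q →L[ℝ] E q :=
  (LinearMap.ker (φ.form q : E q →ₗ[ℝ] ℝ)).subtypeL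

/-- A vector of the kernel, as a point of the kernel bundle. -/
def toKer (q : Q) (v : E q) (h : φ.form q v = 0) : φ.Ker q := ⟨v, h⟩

@[simp] theorem incl_toKer (q : Q) (v : E q) (h : φ.form q v = 0) : φ.incl q (φ.toKer q v h) = v := rfl
@[simp] theorem form_incl (q : Q) (v : φ.Ker q) : φ.form q (φ.incl q v) = 0 := v.2
theorem incl_injective (q : Q) : Function.Injective (φ.incl q) := Subtype.val_injective

/-- The model fibre of the kernel bundle. -/
abbrev KerModel (F : Type*) [NormedAddCommGroup F] [NormedSpace ℝ F] : Type :=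
  EuclideanSpace ℝ (Fin (finrank ℝ F - 1))

variable (F) in
/-- A splitting of the typical fibre as a sum of the model fibre of the kernel and a line. -/
abbrev Split := (KerModel F × ℝ) ≃L[ℝ] F

/-- The coordinates in `KerModel F × ℝ` of a vector of `E_q`. -/
def fwd (q₀ : Q) (Θ : Split F) (q : Q) : E q →L[ℝ] KerModel F × ℝ :=
  (Θ.symm : F →L[ℝ] KerModel F × ℝ).comp ((trivializationAt F E q₀).continuousLinearMapAt ℝ q)

/-- The vector of `E_q` with the given coordinates in `KerModel F × ℝ`. -/
def bwd (q₀ : Q) (Θ : Split F) (q : Q) : KerModel F × ℝ →L[ℝ] E q :=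
  ((trivializationAt F E q₀).symmL ℝ q).comp (Θ : KerModel F × ℝ →L[ℝ] F)

theorem fwd_bwd {q₀ : Q} {Θ : Split F} {q : Q} (h : q ∈ (trivializationAt F E q₀).baseSet) (x) :
    fwd (E := E) q₀ Θ q (bwd q₀ Θ q x) = x := by
  simp [fwd, bwd, Trivialization.continuousLinearMapAt_symmL _ h]

theorem bwd_fwd {q₀ : Q} {Θ : Split F} {q : Q} (h : q ∈ (trivializationAt F E q₀).baseSet) (x) :
    bwd (E := E) q₀ Θ q (fwd q₀ Θ q x) = x := by
  have := Trivialization.symmL_continuousLinearMapAt (R := ℝ) (trivializationAt F E q₀) h x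
  simp only [Trivialization.continuousLinearMapAt_apply] at this
  simp [fwd, bwd, this]

theorem contMDiffAt_symmL_const [ContMDiffVectorBundle ∞ F E 𝓘(ℝ, B)]
    {q₀ q : Q} (hq : q ∈ (trivializationAt F E q₀).baseSet) (x : F) :
    ContMDiffAt 𝓘(ℝ, B) (𝓘(ℝ, B).prod 𝓘(ℝ, F)) ∞
      (fun q => TotalSpace.mk' F q ((trivializationAt F E q₀).symmL ℝ q x)) q := by
  rw [Trivialization.contMDiffAt_section_iff _ hq]
  refine (contMDiffAt_const (c := x)).congr_of_eventuallyEq ?_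
  filter_upwards [(trivializationAt F E q₀).open_baseSet.mem_nhds hq] with y hy
  simp [Trivialization.symmL_apply _ hy, Trivialization.apply_mk_symm _ hy]

theorem contMDiffAt_form [FiniteDimensional ℝ F] [ContMDiffVectorBundle ∞ F E 𝓘(ℝ, B)]
    (α : DualSec B F E) {q₀ q : Q}
    (hq : q ∈ (trivializationAt F E q₀).baseSet) (x : F) :
    ContMDiffAt 𝓘(ℝ, B) 𝓘(ℝ, ℝ) ∞
      (fun q => α q ((trivializationAt F E q₀).symmL ℝ q x)) q := by
  have h1 := contMDiffAt_symmL_const (B := B) hq x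
  have h2 := (α.contMDiff q).clm_bundle_apply h1
  rw [contMDiffAt_section] at h2
  exact h2

/-- The vector of `ker φ_q` with first coordinate `u`. -/
def lift (q₀ : Q) (Θ : Split F) (q : Q) (u : KerModel F) : φ.Ker q :=
  φ.toKer q ((φ.form q (bwd q₀ Θ q (0, 1)))⁻¹ • (φ.form q (bwd q₀ Θ q (0, 1)) • bwd q₀ Θ q (u, 0)
    - φ.form q (bwd q₀ Θ q (u, 0)) • bwd q₀ Θ q (0, 1))) (by simp [mul_comm])

/-- The first coordinate of a vector of `ker φ_q`. -/
def coord (q₀ : Q) (Θ : Split F) (q : Q) (v : φ.Ker q) : KerModel F := (fwd q₀ Θ q (φ.incl q v)).1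

/-- The open set on which `lift` and `coord` are inverse to each other. -/
def base (q₀ : Q) (Θ : Split F) : Set Q :=
  {q | q ∈ (trivializationAt F E q₀).baseSet ∧ φ.form q (bwd q₀ Θ q (0, 1)) ≠ 0}

theorem incl_lift {q₀ : Q} {Θ : Split F} {q : Q} (h : q ∈ φ.base q₀ Θ) (u : KerModel F) :
    φ.incl q (φ.lift q₀ Θ q u) = bwd q₀ Θ q (u, 0) - ((φ.form q (bwd q₀ Θ q (0, 1)))⁻¹ *
      φ.form q (bwd q₀ Θ q (u, 0))) • bwd q₀ Θ q (0, 1) := by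
  rw [lift, incl_toKer, smul_sub, smul_smul, smul_smul, inv_mul_cancel₀ h.2, one_smul]

theorem coord_add (q₀ : Q) (Θ : Split F) (q : Q) (v w : φ.Ker q) :
    φ.coord q₀ Θ q (v + w) = φ.coord q₀ Θ q v + φ.coord q₀ Θ q w := by
  simp [coord]

theorem coord_smul (q₀ : Q) (Θ : Split F) (q : Q) (c : ℝ) (v : φ.Ker q) :
    φ.coord q₀ Θ q (c • v) = c • φ.coord q₀ Θ q v := by
  simp [coord]

theorem lift_add (q₀ : Q) (Θ : Split F) (q : Q) (u v : KerModel F) :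
    φ.lift q₀ Θ q (u + v) = φ.lift q₀ Θ q u + φ.lift q₀ Θ q v := by
  apply φ.incl_injective
  have h : ((u + v, 0) : KerModel F × ℝ) = (u, 0) + (v, 0) := by simp
  simp only [lift, incl_toKer, h, map_add]
  module

theorem lift_smul (q₀ : Q) (Θ : Split F) (q : Q) (c : ℝ) (u : KerModel F) :
    φ.lift q₀ Θ q (c • u) = c • φ.lift q₀ Θ q u := by
  apply φ.incl_injective
  have h : ((c • u, 0) : KerModel F × ℝ) = c • (u, 0) := by simp
  simp only [lift, incl_toKer, h, map_smul, smul_eq_mul]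
  module

theorem coord_lift {q₀ : Q} {Θ : Split F} {q : Q} (h : q ∈ φ.base q₀ Θ) (u : KerModel F) :
    φ.coord q₀ Θ q (φ.lift q₀ Θ q u) = u := by
  simp [coord, incl_lift _ h, fwd_bwd h.1]

theorem lift_coord {q₀ : Q} {Θ : Split F} {q : Q} (h : q ∈ φ.base q₀ Θ) (v : φ.Ker q) :
    φ.lift q₀ Θ q (φ.coord q₀ Θ q v) = v := by
  apply φ.incl_injective
  rw [incl_lift _ h]
  set x := fwd q₀ Θ q (φ.incl q v) with hx
  have h1 : φ.incl q v = bwd q₀ Θ q (x.1, 0) + x.2 • bwd q₀ Θ q (0, 1) := by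
    rw [← map_smul, ← map_add]
    simp [hx, bwd_fwd h.1]
  have h2 := φ.form_incl q v
  rw [h1] at h2 ⊢
  simp only [map_add, map_smul, smul_eq_mul] at h2
  have h3 : φ.form q (bwd q₀ Θ q (x.1, 0)) = - (x.2 * φ.form q (bwd q₀ Θ q (0, 1))) := by linarith
  have h4 := h.2
  have : φ.coord q₀ Θ q v = x.1 := rfl
  rw [this, h3]
  have h5 : (φ.form q (bwd q₀ Θ q (0, 1)))⁻¹ * -(x.2 * φ.form q (bwd q₀ Θ q (0, 1))) = - x.2 := by
    field_simp
  rw [h5]; simp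

theorem exists_split [FiniteDimensional ℝ F] (q₀ : Q) : ∃ Θ : Split F, q₀ ∈ φ.base q₀ Θ := by
  have hb := FiberBundle.mem_baseSet_trivializationAt' (F := F) (E := E) q₀
  obtain ⟨v, hv⟩ : ∃ v, φ.form q₀ v ≠ 0 := by
    by_contra! h
    exact φ.ne_zero q₀ (ContinuousLinearMap.ext h)
  set w := (trivializationAt F E q₀).continuousLinearMapAt ℝ q₀ v with hw
  have hwv : (trivializationAt F E q₀).symmL ℝ q₀ w = v :=
    Trivialization.symmL_continuousLinearMapAt _ hb v
  have hw0 : w ≠ 0 := by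
    intro h
    rw [h, map_zero] at hwv
    exact hv (by rw [← hwv, map_zero])
  obtain ⟨f, hf⟩ : ∃ f : F →L[ℝ] ℝ, f w = 1 := by
    obtain ⟨g, hg⟩ := SeparatingDual.exists_eq_one (R := ℝ) hw0
    exact ⟨g, hg⟩
  have hfin : finrank ℝ (LinearMap.ker (f : F →ₗ[ℝ] ℝ)) = finrank ℝ (KerModel F) := by
    have h1 := LinearMap.finrank_range_add_finrank_ker (f : F →ₗ[ℝ] ℝ)
    have h2 : LinearMap.range (f : F →ₗ[ℝ] ℝ) = ⊤ :=
      LinearMap.range_eq_top.2 fun c => ⟨c • w, by simp [hf]⟩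
    rw [h2, finrank_top, finrank_self] at h1
    rw [finrank_euclideanSpace_fin]
    omega
  let K := LinearEquiv.ofFinrankEq _ _ hfin
  let P : F →ₗ[ℝ] LinearMap.ker (f : F →ₗ[ℝ] ℝ) :=
    LinearMap.codRestrict _ (LinearMap.id - (f : F →ₗ[ℝ] ℝ).smulRight w) (fun x => by simp [hf])
  have hP : ∀ x, (P x : F) = x - f x • w := fun x => rfl
  let L : F ≃ₗ[ℝ] KerModel F × ℝ :=
    { (K.toLinearMap.comp P).prod (f : F →ₗ[ℝ] ℝ) with
      invFun := fun y => (K.symm y.1 : F) + y.2 • w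
      left_inv := fun x => by simp [hP]
      right_inv := fun y => by
        have h3 : f (K.symm y.1 : F) = 0 := (K.symm y.1).2
        have h5 : P ((K.symm y.1 : F) + y.2 • w) = K.symm y.1 := by
          ext
          simp [hP, h3, hf]
        ext1
        · simp [h5]
        · simp [h3, hf] }
  refine ⟨L.toContinuousLinearEquiv.symm, hb, ?_⟩
  have h4 : L.toContinuousLinearEquiv.symm (0, 1) = w := by
    change ((K.symm 0 : LinearMap.ker (f : F →ₗ[ℝ] ℝ)) : F) + (1 : ℝ) • w = w
    simp
  change φ.form q₀ ((trivializationAt F E q₀).symmL ℝ q₀ (L.toContinuousLinearEquiv.symm (0, 1))) ≠ 0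
  rw [h4, hwv]
  exact hv


variable [FiniteDimensional ℝ F] [ContMDiffVectorBundle ∞ F E 𝓘(ℝ, B)]

theorem isOpen_base (q₀ : Q) (Θ : Split F) : IsOpen (φ.base q₀ Θ) := by
  have h : ContinuousOn (fun q => φ.form q (bwd q₀ Θ q (0, 1))) (trivializationAt F E q₀).baseSet :=
    fun q hq => (contMDiffAt_form φ.form hq (Θ (0, 1))).continuousAt.continuousWithinAt
  exact h.isOpen_inter_preimage (trivializationAt F E q₀).open_baseSet isOpen_compl_singleton

/-- Local trivialisation of the kernel bundle. -/
def triv (q₀ : Q) (Θ : Split F) : Pretrivialization (KerModel F) (π (KerModel F) φ.Ker) where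
  toFun p := (p.1, φ.coord q₀ Θ p.1 p.2)
  invFun p := ⟨p.1, φ.lift q₀ Θ p.1 p.2⟩
  source := π (KerModel F) φ.Ker ⁻¹' φ.base q₀ Θ
  target := φ.base q₀ Θ ×ˢ Set.univ
  map_source' p hp := ⟨hp, trivial⟩
  map_target' p hp := hp.1
  left_inv' := by
    rintro ⟨q, v⟩ hp
    simp [φ.lift_coord hp]
  right_inv' := by
    rintro ⟨q, v⟩ hp
    simp [φ.coord_lift hp.1]
  open_target := (φ.isOpen_base q₀ Θ).prod isOpen_univ
  baseSet := φ.base q₀ Θ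
  open_baseSet := φ.isOpen_base q₀ Θ
  source_eq := rfl
  target_eq := rfl
  proj_toFun _ _ := rfl

theorem triv_symm {q₀ : Q} {Θ : Split F} {q : Q} (h : q ∈ φ.base q₀ Θ) (u : KerModel F) :
    (φ.triv q₀ Θ).symm q u = φ.lift q₀ Θ q u := by
  have h1 := (φ.triv q₀ Θ).mk_symm h u
  exact TotalSpace.mk_inj.1 h1

instance triv_linear (q₀ : Q) (Θ : Split F) : (φ.triv q₀ Θ).IsLinear ℝ where
  linear q _ := ⟨fun x y => φ.coord_add q₀ Θ q x y, fun c x => φ.coord_smul q₀ Θ q c x⟩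

/-- The change of coordinates between two local trivialisations. -/
def change (q₀ : Q) (Θ : Split F) (q₁ : Q) (Θ' : Split F) (q : Q) : KerModel F →L[ℝ] KerModel F :=
  LinearMap.toContinuousLinearMap
  { toFun := fun u => φ.coord q₁ Θ' q (φ.lift q₀ Θ q u)
    map_add' := fun u v => by rw [lift_add, coord_add]
    map_smul' := fun c v => by rw [lift_smul, coord_smul]; rfl }

theorem contMDiffOn_change (q₀ : Q) (Θ : Split F) (q₁ : Q) (Θ' : Split F) :
    ContMDiffOn 𝓘(ℝ, B) 𝓘(ℝ, KerModel F →L[ℝ] KerModel F) ∞ (φ.change q₀ Θ q₁ Θ')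
      (φ.base q₀ Θ ∩ φ.base q₁ Θ') := by
  rintro q ⟨h0, h1⟩
  refine (contMDiffAt_clm fun u => ?_).contMDiffWithinAt
  have hs : ContMDiffAt 𝓘(ℝ, B) 𝓘(ℝ, ℝ) ∞ (fun q => (φ.form q (bwd q₀ Θ q (0, 1)))⁻¹ *
      φ.form q (bwd q₀ Θ q (u, 0))) q :=
    ((contMDiffAt_form φ.form h0.1 _).inv₀ h0.2).mul (contMDiffAt_form φ.form h0.1 _)
  have hc := contMDiffAt_coordChangeL (IB := 𝓘(ℝ, B)) (n := ∞) h0.1 h1.1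
  have h2 := (hc.clm_apply (contMDiffAt_const (c := Θ (u, 0)))).sub
    (hs.smul (hc.clm_apply (contMDiffAt_const (c := Θ (0, 1)))))
  have h3 := (((ContinuousLinearMap.fst ℝ (KerModel F) ℝ).comp
    (Θ'.symm : F →L[ℝ] KerModel F × ℝ)).contMDiff (n := ∞)).contMDiffAt.comp q h2
  refine h3.congr_of_eventuallyEq ?_
  filter_upwards [(φ.isOpen_base q₀ Θ).mem_nhds h0, (φ.isOpen_base q₁ Θ').mem_nhds h1] with y hy hy'
  have h4 : ∀ x, (trivializationAt F E q₁).continuousLinearMapAt ℝ y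
      ((trivializationAt F E q₀).symmL ℝ y x) =
      (trivializationAt F E q₀).coordChangeL ℝ (trivializationAt F E q₁) y x := by
    intro x
    rw [Trivialization.coordChangeL_apply _ _ ⟨hy.1, hy'.1⟩, Trivialization.symmL_apply _ hy.1,
      Trivialization.continuousLinearMapAt_apply, Trivialization.linearMapAt_apply]
    simp [hy'.1]
  change φ.coord q₁ Θ' y (φ.lift q₀ Θ y u) = _
  rw [coord, incl_lift _ hy]
  simp only [map_sub, map_smul, fwd, bwd, ContinuousLinearMap.comp_apply, h4]
  simp

theorem change_apply {q₀ : Q} {Θ : Split F} {q₁ : Q} {Θ' : Split F} {q : Q}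
    (h : q ∈ φ.base q₀ Θ) (u : KerModel F) :
    φ.change q₀ Θ q₁ Θ' q u = (φ.triv q₁ Θ' ⟨q, (φ.triv q₀ Θ).symm q u⟩).2 := by
  rw [triv_symm _ h]; rfl

/-- The kernel of a nowhere vanishing form as a vector bundle, topologised so that the restrictions
to the kernel of smooth local coordinates of the ambient bundle are trivialisations. -/
def prebundle : VectorPrebundle ℝ (KerModel F) φ.Ker where
  pretrivializationAtlas := {t | ∃ q₀ Θ, t = φ.triv q₀ Θ}
  pretrivialization_linear' := by rintro _ ⟨q₀, Θ, rfl⟩; infer_instance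
  pretrivializationAt q := φ.triv q (φ.exists_split q).choose
  mem_base_pretrivializationAt q := (φ.exists_split q).choose_spec
  pretrivialization_mem_atlas q := ⟨_, _, rfl⟩
  exists_coordChange := by
    rintro _ ⟨q₀, Θ, rfl⟩ _ ⟨q₁, Θ', rfl⟩
    exact ⟨φ.change q₀ Θ q₁ Θ', (φ.contMDiffOn_change q₀ Θ q₁ Θ').continuousOn,
      fun q hq u => φ.change_apply hq.1 u⟩
  totalSpaceMk_isInducing q := by
    have h0 := (φ.exists_split q).choose_spec
    set Θ := (φ.exists_split q).choose
    have hc : Continuous (φ.coord q Θ q) :=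
      continuous_fst.comp ((fwd q Θ q).continuous.comp (φ.incl q).continuous)
    have hl : Continuous (φ.lift q Θ q) := by
      refine Continuous.subtype_mk ?_ _
      have : IsTopologicalAddGroup (E q) := (VectorBundle.continuousLinearEquivAt ℝ F E
        q).toContinuousAddEquiv.isTopologicalAddGroup
      have : ContinuousSMul ℝ (E q) := (VectorBundle.continuousLinearEquivAt ℝ F E
        q).continuousSMul
      fun_prop
    have h1 : Topology.IsInducing (φ.coord q Θ q) :=
      (Homeomorph.mk ⟨φ.coord q Θ q, φ.lift q Θ q, φ.lift_coord h0, φ.coord_lift h0⟩ hc hl).isInducing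
    have h2 : Topology.IsInducing (fun u : KerModel F => (q, u)) := isInducing_prodMkRight q
    exact h2.comp h1

instance : φ.prebundle.IsContMDiff 𝓘(ℝ, B) ∞ where
  exists_contMDiffCoordChange := by
    intro e he e' he'
    obtain ⟨q₀, Θ, rfl⟩ : ∃ q₀ Θ, e = φ.triv q₀ Θ := he
    obtain ⟨q₁, Θ', rfl⟩ : ∃ q₀ Θ, e' = φ.triv q₀ Θ := he'
    exact ⟨φ.change q₀ Θ q₁ Θ', φ.contMDiffOn_change q₀ Θ q₁ Θ',
      fun q hq u => φ.change_apply hq.1 u⟩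

instance : TopologicalSpace (TotalSpace (KerModel F) φ.Ker) := φ.prebundle.totalSpaceTopology
instance : FiberBundle (KerModel F) φ.Ker := φ.prebundle.toFiberBundle
instance : VectorBundle ℝ (KerModel F) φ.Ker := φ.prebundle.toVectorBundle
instance : ContMDiffVectorBundle ∞ (KerModel F) φ.Ker 𝓘(ℝ, B) :=
  φ.prebundle.contMDiffVectorBundle 𝓘(ℝ, B)


theorem contMDiffAt_iff_incl {s : ∀ q, φ.Ker q} {q₀ : Q} :
    ContMDiffAt 𝓘(ℝ, B) (𝓘(ℝ, B).prod 𝓘(ℝ, KerModel F)) ∞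
      (fun q => TotalSpace.mk' (KerModel F) q (s q)) q₀ ↔
    ContMDiffAt 𝓘(ℝ, B) (𝓘(ℝ, B).prod 𝓘(ℝ, F)) ∞
      (fun q => TotalSpace.mk' F q (φ.incl q (s q))) q₀ := by
  rw [contMDiffAt_section, contMDiffAt_section]
  have hb := (φ.exists_split q₀).choose_spec
  set Θ := (φ.exists_split q₀).choose with hΘ
  have h1 : (fun q => (trivializationAt (KerModel F) φ.Ker q₀ ⟨q, s q⟩).2) =
    fun q => φ.coord q₀ Θ q (s q) := rfl
  rw [h1]
  have hbase := (φ.isOpen_base q₀ Θ).mem_nhds hb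
  constructor
  · intro h
    have hs := (((contMDiffAt_form φ.form hb.1 (Θ (0, 1))).inv₀ hb.2))
    have h2 : ContMDiffAt 𝓘(ℝ, B) 𝓘(ℝ, F) ∞ (fun q => Θ (φ.coord q₀ Θ q (s q), 0)) q₀ :=
      ((Θ : KerModel F × ℝ →L[ℝ] F).comp
        (ContinuousLinearMap.inl ℝ (KerModel F) ℝ)).contMDiff.contMDiffAt.comp q₀ h
    have h3 : ContMDiffAt 𝓘(ℝ, B) 𝓘(ℝ, ℝ) ∞
        (fun q => φ.form q (bwd q₀ Θ q (φ.coord q₀ Θ q (s q), 0))) q₀ := by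
      have h4 := (contMDiffAt_clm (f := fun q => (φ.form q).comp
        ((trivializationAt F E q₀).symmL ℝ q))
        (fun v => contMDiffAt_form φ.form hb.1 v)).clm_apply h2
      exact h4
    have h5 := h2.sub ((hs.mul h3).smul (contMDiffAt_const (c := Θ (0, 1))))
    refine h5.congr_of_eventuallyEq ?_
    filter_upwards [hbase] with y hy
    have h6 := φ.incl_lift hy (φ.coord q₀ Θ y (s y))
    rw [lift_coord _ hy] at h6
    have h7 : ∀ x : F, ((trivializationAt F E q₀).linearMapAt ℝ y)
        ((trivializationAt F E q₀).symmL ℝ y x) = x := fun x =>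
      Trivialization.continuousLinearMapAt_symmL _ hy.1 x
    have h8 : ∀ v : E y, (trivializationAt F E q₀ ⟨y, v⟩).2 =
        (trivializationAt F E q₀).linearMapAt ℝ y v := fun v => by
      rw [Trivialization.linearMapAt_apply, if_pos hy.1]
    rw [h8, h6, map_sub, map_smul]
    simp only [bwd, ContinuousLinearMap.comp_apply, h7]
    rfl
  · intro h
    have h2 := ((ContinuousLinearMap.fst ℝ (KerModel F) ℝ).comp
      (Θ.symm : F →L[ℝ] KerModel F × ℝ)).contMDiff (n := ∞) |>.contMDiffAt.comp q₀ h
    refine h2.congr_of_eventuallyEq ?_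
    filter_upwards [hbase] with y hy
    simp [coord, fwd, Trivialization.linearMapAt_apply, hy.1]

/-- A section of the kernel bundle as a section of the ambient bundle. -/
def inclSec (s : Sec B (KerModel F) φ.Ker) : Sec B F E :=
  ⟨fun q => φ.incl q (s q), fun q => φ.contMDiffAt_iff_incl.1 (s.contMDiff q)⟩

/-- A section of the ambient bundle with values in the kernel as a section of the kernel bundle. -/
def toKerSec (s : Sec B F E) (hs : ∀ q, φ.form q (s q) = 0) : Sec B (KerModel F) φ.Ker :=
  ⟨fun q => φ.toKer q (s q) (hs q), fun q => φ.contMDiffAt_iff_incl.2 (s.contMDiff q)⟩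

instance (q : Q) : IsTopologicalAddGroup (φ.Ker q) :=
  (VectorBundle.continuousLinearEquivAt ℝ (KerModel F) φ.Ker q).toContinuousAddEquiv.isTopologicalAddGroup
instance (q : Q) : ContinuousSMul ℝ (φ.Ker q) :=
  (VectorBundle.continuousLinearEquivAt ℝ (KerModel F) φ.Ker q).continuousSMul

end NowhereZero

/-- The product of a smooth function and a smooth section. -/
def smulSec (f : C^∞⟮𝓘(ℝ, B), Q; 𝓘(ℝ), ℝ⟯) (s : Sec B F E) : Sec B F E :=
  ⟨fun q => f q • s q, f.contMDiff.smul_section s.contMDiff⟩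

variable (B) in
/-- The derivative `v(f)` of a function `f` on `Q` along a tangent vector `v` at `q`. -/
def dirDeriv {q : Q} (v : TangentSpace 𝓘(ℝ, B) q) (f : Q → ℝ) : ℝ := mfderiv 𝓘(ℝ, B) 𝓘(ℝ) f q v

variable (B F E) in
/-- A skew-symmetric algebroid structure on the vector bundle `E`: a skew-symmetric bilinear
bracket on the smooth sections and a bundle map `E → TQ` which satisfy the Leibniz rule. -/
structure SkewAlgebroid [IsManifold 𝓘(ℝ, B) ∞ Q] where
  bracket : Sec B F E →ₗ[ℝ] Sec B F E →ₗ[ℝ] Sec B F E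
  anchor : Sec B (F →L[ℝ] B) (fun q => E q →L[ℝ] TangentSpace 𝓘(ℝ, B) q)
  skew : ∀ σ γ, bracket σ γ = - bracket γ σ
  leibniz : ∀ σ γ f q, bracket σ (smulSec f γ) q =
    f q • bracket σ γ q + dirDeriv B (anchor q (σ q)) f • γ q

section
variable [FiniteDimensional ℝ F] [ContMDiffVectorBundle ∞ F E 𝓘(ℝ, B)] (φ : NowhereZero B F E)

variable {φ} in
theorem Sec.ker_ext {s t : Sec B (NowhereZero.KerModel F) φ.Ker}
    (h : ∀ q, φ.inclSec s q = φ.inclSec t q) : s = t :=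
  ContMDiffSection.ext fun q => φ.incl_injective q (h q)

theorem NowhereZero.inclSec_add (s t : Sec B (NowhereZero.KerModel F) φ.Ker) :
    φ.inclSec (s + t) = φ.inclSec s + φ.inclSec t :=
  ContMDiffSection.ext fun q => map_add (φ.incl q) (s q) (t q)

theorem NowhereZero.inclSec_smul (c : ℝ) (s : Sec B (NowhereZero.KerModel F) φ.Ker) :
    φ.inclSec (c • s) = c • φ.inclSec s :=
  ContMDiffSection.ext fun q => map_smul (φ.incl q) c (s q)

end

namespace SkewAlgebroid
variable [IsManifold 𝓘(ℝ, B) ∞ Q] (A : SkewAlgebroid B F E)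

/-- The almost differential of a section `α` of the dual bundle, evaluated on two sections:
`dα(σ, γ) = ρ(σ)(α(γ)) - ρ(γ)(α(σ)) - α([σ, γ])`. -/
def d (α : DualSec B F E) (σ γ : Sec B F E) (q : Q) : ℝ :=
  dirDeriv B (A.anchor q (σ q)) (fun x => α x (γ x)) -
    dirDeriv B (A.anchor q (γ q)) (fun x => α x (σ x)) - α q (A.bracket σ γ q)

variable {A}
variable [FiniteDimensional ℝ F] [ContMDiffVectorBundle ∞ F E 𝓘(ℝ, B)]

theorem form_bracket (φ : NowhereZero B F E) (h : ∀ σ γ q, A.d φ.form σ γ q = 0)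
    (σ γ : Sec B (NowhereZero.KerModel F) φ.Ker) (q : Q) :
    φ.form q (A.bracket (φ.inclSec σ) (φ.inclSec γ) q) = 0 := by
  have h1 := h (φ.inclSec σ) (φ.inclSec γ) q
  have h2 : ∀ s : Sec B (NowhereZero.KerModel F) φ.Ker,
      (fun x => φ.form x (φ.inclSec s x)) = fun _ => (0 : ℝ) := fun s =>
    funext fun x => φ.form_incl x (s x)
  rw [d, h2, h2] at h1
  have h3 : ∀ v : TangentSpace 𝓘(ℝ, B) q, dirDeriv B v (fun _ : Q => (0 : ℝ)) = 0 := fun v => by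
    simp [dirDeriv, mfderiv_const]
    rfl
  rw [h3, h3] at h1
  linarith

variable (A) in
/-- The skew-symmetric algebroid structure on the kernel bundle of a `1`-cocycle. -/
def ker (φ : NowhereZero B F E) (h : ∀ σ γ q, A.d φ.form σ γ q = 0) :
    SkewAlgebroid B (NowhereZero.KerModel F) φ.Ker where
  bracket := LinearMap.mk₂ ℝ
    (fun σ γ => φ.toKerSec (A.bracket (φ.inclSec σ) (φ.inclSec γ)) (form_bracket φ h σ γ))
    (fun σ τ γ => Sec.ker_ext fun q => by
      have h : A.bracket (φ.inclSec (σ + τ)) (φ.inclSec γ) =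
          A.bracket (φ.inclSec σ) (φ.inclSec γ) + A.bracket (φ.inclSec τ) (φ.inclSec γ) := by
        rw [φ.inclSec_add, map_add, LinearMap.add_apply]
      exact DFunLike.congr_fun h q)
    (fun c σ γ => Sec.ker_ext fun q => by
      have h : A.bracket (φ.inclSec (c • σ)) (φ.inclSec γ) =
          c • A.bracket (φ.inclSec σ) (φ.inclSec γ) := by
        rw [φ.inclSec_smul, map_smul, LinearMap.smul_apply]
      exact DFunLike.congr_fun h q)
    (fun σ γ τ => Sec.ker_ext fun q => by
      have h : A.bracket (φ.inclSec σ) (φ.inclSec (γ + τ)) =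
          A.bracket (φ.inclSec σ) (φ.inclSec γ) + A.bracket (φ.inclSec σ) (φ.inclSec τ) := by
        rw [φ.inclSec_add, map_add]
      exact DFunLike.congr_fun h q)
    (fun c σ γ => Sec.ker_ext fun q => by
      have h : A.bracket (φ.inclSec σ) (φ.inclSec (c • γ)) =
          c • A.bracket (φ.inclSec σ) (φ.inclSec γ) := by
        rw [φ.inclSec_smul, map_smul]
      exact DFunLike.congr_fun h q)
  anchor := ⟨fun q => (A.anchor q).comp (φ.incl q), fun q => contMDiffAt_hom fun v =>
    ((A.anchor.contMDiff q).clm_bundle_apply (φ.contMDiffAt_iff_incl.1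
      (NowhereZero.contMDiffAt_symmL_const (FiberBundle.mem_baseSet_trivializationAt' q) v)))⟩
  skew σ γ := Sec.ker_ext fun q => DFunLike.congr_fun (A.skew (φ.inclSec σ) (φ.inclSec γ)) q
  leibniz σ γ f q := φ.incl_injective q (by
    rw [map_add, map_smul, map_smul]
    exact A.leibniz (φ.inclSec σ) (φ.inclSec γ) f q)
end SkewAlgebroid

/-- The isomorphism `♭ : W → W*` induced by a positive definite bilinear form. -/
def flatEquiv {W : Type*} [AddCommGroup W] [Module ℝ W] [TopologicalSpace W]
    [IsTopologicalAddGroup W] [ContinuousSMul ℝ W] [T2Space W] [FiniteDimensional ℝ W]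
    (g : W →L[ℝ] W →L[ℝ] ℝ) (hg : ∀ v, v ≠ 0 → 0 < g v v) : W ≃ₗ[ℝ] (W →L[ℝ] ℝ) :=
  let i : (W →L[ℝ] ℝ) ≃ₗ[ℝ] (W →ₗ[ℝ] ℝ) := LinearMap.toContinuousLinearMap.symm
  have : FiniteDimensional ℝ (W →L[ℝ] ℝ) := i.symm.finiteDimensional
  LinearEquiv.ofInjectiveOfFinrankEq (g : W →ₗ[ℝ] (W →L[ℝ] ℝ))
    (by
      rw [injective_iff_map_eq_zero]
      intro v hv
      by_contra h
      have h1 := hg v h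
      have h2 : g v = 0 := hv
      rw [h2] at h1
      exact lt_irrefl _ h1)
    (i.finrank_eq.trans (Subspace.dual_finrank_eq (K := ℝ) (V := W))).symm

theorem flatEquiv_apply {W : Type*} [AddCommGroup W] [Module ℝ W] [TopologicalSpace W]
    [IsTopologicalAddGroup W] [ContinuousSMul ℝ W] [T2Space W] [FiniteDimensional ℝ W]
    (g : W →L[ℝ] W →L[ℝ] ℝ) (hg : ∀ v, v ≠ 0 → 0 < g v v) (v : W) : flatEquiv g hg v = g v := rfl

section Metric
variable [FiniteDimensional ℝ F] (G : ContMDiffRiemannianMetric 𝓘(ℝ, B) ∞ F E)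

/-- The isomorphism `♭_G : E_q → E_q*` of a bundle metric. -/
def flat (q : Q) : E q ≃ₗ[ℝ] (E q →L[ℝ] ℝ) :=
  have := FiberBundle.t2Space F E q
  have := VectorBundle.finiteDimensional ℝ F E q
  have := (VectorBundle.continuousLinearEquivAt ℝ F E q).toContinuousAddEquiv.isTopologicalAddGroup
  have := (VectorBundle.continuousLinearEquivAt ℝ F E q).continuousSMul
  flatEquiv (G.inner q) (G.pos q)

theorem flat_apply (q : Q) (v w : E q) : flat G q v w = G.inner q v w := rfl

theorem inner_flat_symm (q : Q) (α : E q →L[ℝ] ℝ) (w : E q) :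
    G.inner q ((flat G q).symm α) w = α w := by
  rw [← flat_apply, LinearEquiv.apply_symm_apply]

/-- The section `♭_G⁻¹ ∘ α`. -/
def sharp [ContMDiffVectorBundle ∞ F E 𝓘(ℝ, B)] (α : DualSec B F E) : Sec B F E :=
  ⟨fun q => (flat G q).symm (α q), fun q₀ => by
    rw [contMDiffAt_section]
    have h1 := G.contMDiff q₀
    rw [contMDiffAt_hom_bundle] at h1
    have h2 := α.contMDiff q₀
    rw [contMDiffAt_section] at h2
    set e := trivializationAt F E q₀
    set e' := trivializationAt (F →L[ℝ] ℝ) (fun q => E q →L[ℝ] ℝ) q₀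
    set M : Q → F →L[ℝ] F →L[ℝ] ℝ := fun q => ContinuousLinearMap.inCoordinates F E (F →L[ℝ] ℝ)
      (fun q => E q →L[ℝ] ℝ) q₀ q q₀ q (G.inner q) with hM
    have h3 : ContMDiffAt 𝓘(ℝ, B) 𝓘(ℝ, F →L[ℝ] F →L[ℝ] ℝ) ∞ M q₀ := h1.2
    have hq : q₀ ∈ e.baseSet := FiberBundle.mem_baseSet_trivializationAt' q₀
    have hq' : q₀ ∈ e'.baseSet := FiberBundle.mem_baseSet_trivializationAt' q₀
    have hinv : ∀ q ∈ e.baseSet ∩ e'.baseSet, ContinuousLinearMap.IsInvertible (M q) ∧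
        ∀ v : E q, M q (e ⟨q, v⟩).2 = (e' ⟨q, G.inner q v⟩).2 := by
      intro q hq
      let L : F ≃ₗ[ℝ] (F →L[ℝ] ℝ) :=
        ((e.continuousLinearEquivAt ℝ q hq.1).symm.toLinearEquiv.trans (flat G q)).trans
          (e'.continuousLinearEquivAt ℝ q hq.2).toLinearEquiv
      have hL : (L.toContinuousLinearEquiv : F →L[ℝ] F →L[ℝ] ℝ) = M q := by
        simp only [hM]
        rw [ContinuousLinearMap.inCoordinates_eq hq.1 hq.2]
        rfl
      refine ⟨⟨_, hL⟩, fun v => ?_⟩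
      rw [← hL]
      change (e' ⟨q, flat G q ((e.continuousLinearEquivAt ℝ q hq.1).symm
        (e.continuousLinearEquivAt ℝ q hq.1 v))⟩).2 = _
      rw [ContinuousLinearEquiv.symm_apply_apply]
      rfl
    have h4 := ((hinv q₀ ⟨hq, hq'⟩).1.contDiffAt_map_inverse (n := ∞)).contMDiffAt.comp q₀ h3
    refine (h4.clm_apply h2).congr_of_eventuallyEq ?_
    filter_upwards [e.open_baseSet.mem_nhds hq, e'.open_baseSet.mem_nhds hq'] with q hq hq'
    have h5 := (hinv q ⟨hq, hq'⟩).2 ((flat G q).symm (α q))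
    have h6 : G.inner q ((flat G q).symm (α q)) = α q := (flat G q).apply_symm_apply (α q)
    rw [h6] at h5
    exact ((hinv q ⟨hq, hq'⟩).1.inverse_apply_eq.2 h5.symm).symm⟩

theorem inner_sharp [ContMDiffVectorBundle ∞ F E 𝓘(ℝ, B)] (α : DualSec B F E) (q : Q) (w : E q) :
    G.inner q (sharp G α q) w = α q w := inner_flat_symm G q (α q) w

end Metric

section mechanical
variable [FiniteDimensional ℝ F] [ContMDiffVectorBundle ∞ F E 𝓘(ℝ, B)] [IsManifold 𝓘(ℝ, B) ∞ Q]

variable (B F E) in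
/-- An unconstrained mechanical system on a skew-symmetric algebroid with a nowhere vanishing
`1`-cocycle `φ`: a bundle metric and a potential on the base. The metric is normalised by
`G(𝒳, 𝒳) = 1`, where `𝒳 = ♭_G⁻¹ ∘ φ`. -/
structure MechanicalSystem where
  algebroid : SkewAlgebroid B F E
  φ : NowhereZero B F E
  cocycle : ∀ σ γ q, algebroid.d φ.form σ γ q = 0
  metric : ContMDiffRiemannianMetric 𝓘(ℝ, B) ∞ F E
  potential : C^∞⟮𝓘(ℝ, B), Q; 𝓘(ℝ), ℝ⟯
  unit : ∀ q, metric.inner q (sharp metric φ.form q) (sharp metric φ.form q) = 1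

namespace MechanicalSystem
open NowhereZero
variable (S : MechanicalSystem B F E)

/-- The section `𝒳 = ♭_G⁻¹ ∘ φ` of `E`. -/
def X : Sec B F E := sharp S.metric S.φ.form

theorem form_X (q : Q) : S.φ.form q (S.X q) = 1 := by
  rw [← S.unit q, inner_sharp]; rfl

/-- The fibre `V_q` of the kernel of `φ`. -/
abbrev V (q : Q) : Type _ := S.φ.Ker q

/-- The total space of `V*`. -/
abbrev VDual : Type _ := TotalSpace (KerModel F →L[ℝ] ℝ) (fun q => S.φ.Ker q →L[ℝ] ℝ)

/-- The induced structure of skew-symmetric algebroid on `V`. -/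
def kerAlgebroid : SkewAlgebroid B (KerModel F) S.φ.Ker := S.algebroid.ker S.φ S.cocycle

/-- The projection `E_q = ⟨𝒳(q)⟩ ⊕ V_q → V_q`. -/
def pr (q : Q) : E q →L[ℝ] S.φ.Ker q :=
  have := (VectorBundle.continuousLinearEquivAt ℝ F E q).toContinuousAddEquiv.isTopologicalAddGroup
  have := (VectorBundle.continuousLinearEquivAt ℝ F E q).continuousSMul
  ContinuousLinearMap.codRestrict (ContinuousLinearMap.id ℝ (E q) - (S.φ.form q).smulRight (S.X q))
    (LinearMap.ker (S.φ.form q : E q →ₗ[ℝ] ℝ)) (fun v => by simp [S.form_X])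

theorem incl_pr (q : Q) (v : E q) : S.φ.incl q (S.pr q v) = v - S.φ.form q v • S.X q := rfl

theorem pr_incl (q : Q) (v : S.φ.Ker q) : S.pr q (S.φ.incl q v) = v :=
  S.φ.incl_injective q (by simp [incl_pr])

theorem pr_X (q : Q) : S.pr q (S.X q) = 0 :=
  S.φ.incl_injective q (by simp [incl_pr, form_X])

/-- The bundle metric on `V`. -/
def kerMetric (q : Q) : S.φ.Ker q →L[ℝ] S.φ.Ker q →L[ℝ] ℝ :=
  (ContinuousLinearMap.precomp ℝ (S.φ.incl q)).comp ((S.metric.inner q).comp (S.φ.incl q))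

theorem kerMetric_apply (q : Q) (v w : S.φ.Ker q) :
    S.kerMetric q v w = S.metric.inner q (S.φ.incl q v) (S.φ.incl q w) := rfl

/-- The isomorphism `V_q → V_q*` induced by the metric. -/
def kerFlat (q : Q) : S.φ.Ker q ≃ₗ[ℝ] (S.φ.Ker q →L[ℝ] ℝ) :=
  have := FiberBundle.t2Space (KerModel F) S.φ.Ker q
  have := VectorBundle.finiteDimensional ℝ (KerModel F) S.φ.Ker q
  flatEquiv (S.kerMetric q) (fun _ hv => S.metric.pos q _ (fun h => hv (S.φ.incl_injective q
    (h.trans (map_zero (S.φ.incl q)).symm))))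

theorem kerFlat_apply (q : Q) (v w : S.φ.Ker q) : S.kerFlat q v w = S.kerMetric q v w := rfl

/-- The bundle metric on `V*` induced by the metric. -/
def cometric (q : Q) (η η' : S.φ.Ker q →L[ℝ] ℝ) : ℝ :=
  S.kerMetric q ((S.kerFlat q).symm η) ((S.kerFlat q).symm η')

/-- The function `H(η) = ½ G*_V(η, η) + 𝕍` on `V*`. -/
def H (η : S.VDual) : ℝ := 1 / 2 * S.cometric η.1 η.2 η.2 + S.potential η.1

/-- The section `α ∘ pr` of `E*`. -/
def extend (α : DualSec B (KerModel F) S.φ.Ker) : DualSec B F E :=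
  ⟨fun q => (α q).comp (S.pr q), fun q₀ => contMDiffAt_hom fun x => by
    have hq := FiberBundle.mem_baseSet_trivializationAt' (F := F) (E := E) q₀
    have h1 := contMDiffAt_symmL_const (B := B) hq x
    have h2 := contMDiffAt_form S.φ.form hq x
    have h3 := h1.sub_section (h2.smul_section (S.X.contMDiff q₀))
    have h4 := S.φ.contMDiffAt_iff_incl (s := fun q => S.pr q
      ((trivializationAt F E q₀).symmL ℝ q x)) (q₀ := q₀) |>.2 h3
    exact (α.contMDiff q₀).clm_bundle_apply h4⟩

theorem exists_zeta (α : DualSec B (KerModel F) S.φ.Ker) : ∃ ζ : Sec B (KerModel F) S.φ.Ker,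
    (∀ q, ζ q = (S.kerFlat q).symm (α q)) ∧ ∀ q, ∀ β : S.φ.Ker q →L[ℝ] ℝ,
      HasDerivAt (fun t : ℝ => S.H ⟨q, α q + t • β⟩) (β (ζ q)) 0 := by
  have hs : ∀ q, S.φ.form q (sharp S.metric (S.extend α) q) = 0 := by
    intro q
    rw [← inner_sharp S.metric S.φ.form q, S.metric.symm, inner_sharp]
    change α q (S.pr q (S.X q)) = 0
    rw [pr_X, map_zero]
  refine ⟨S.φ.toKerSec _ hs, ?_⟩
  have h0 : ∀ q, S.φ.toKerSec (sharp S.metric (S.extend α)) hs q = (S.kerFlat q).symm (α q) := by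
    intro q
    rw [LinearEquiv.eq_symm_apply]
    ext w
    change S.metric.inner q (sharp S.metric (S.extend α) q) (S.φ.incl q w) = _
    rw [inner_sharp]
    change α q (S.pr q (S.φ.incl q w)) = _
    rw [pr_incl]
  refine ⟨h0, fun q β => ?_⟩
  rw [h0]
  have h1 : ∀ η η' : S.φ.Ker q →L[ℝ] ℝ, S.cometric q η η' = η ((S.kerFlat q).symm η') := by
    intro η η'
    rw [cometric, ← kerFlat_apply, LinearEquiv.apply_symm_apply]
  have h2 : ∀ η η' : S.φ.Ker q →L[ℝ] ℝ, S.cometric q η η' = S.cometric q η' η := fun η η' =>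
    S.metric.symm q _ _
  have h3 : (fun t : ℝ => S.H ⟨q, α q + t • β⟩) = fun t => 1 / 2 * (S.cometric q (α q) (α q) +
      2 * t * S.cometric q β (α q) + t ^ 2 * S.cometric q β β) + S.potential q := by
    ext t
    have h4 : S.cometric q (α q + t • β) (α q + t • β) = S.cometric q (α q) (α q) +
      2 * t * S.cometric q β (α q) + t ^ 2 * S.cometric q β β := by
      have h5 := h2 (α q) β
      simp only [h1, map_add, map_smul, add_apply,
        smul_apply, smul_eq_mul] at h5 ⊢
      rw [h5]; ring
    simp only [H]
    rw [h4]
  rw [h3, ← h1]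
  have h6 := (((((hasDerivAt_id (0 : ℝ)).const_mul 2).mul_const (S.cometric q β (α q))).const_add
    (S.cometric q (α q) (α q))).add (((hasDerivAt_id (0 : ℝ)).pow 2).mul_const
    (S.cometric q β β))).const_mul (1 / 2) |>.add_const (S.potential q)
  refine HasDerivAt.congr_deriv h6 ?_
  simp

/-- The section `ζ_H^α` of `V`: `β(ζ_H^α(q))` is the derivative at `t = 0` of `H(α(q) + tβ)`, for
every `β` in `V_q*`. -/
def zeta (α : DualSec B (KerModel F) S.φ.Ker) : Sec B (KerModel F) S.φ.Ker :=
  (S.exists_zeta α).choose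

theorem hasDerivAt_zeta (α : DualSec B (KerModel F) S.φ.Ker) (q : Q) (β : S.φ.Ker q →L[ℝ] ℝ) :
    HasDerivAt (fun t : ℝ => S.H ⟨q, α q + t • β⟩) (β (S.zeta α q)) 0 :=
  (S.exists_zeta α).choose_spec.2 q β

theorem contMDiff_H (α : DualSec B (KerModel F) S.φ.Ker) :
    ContMDiff 𝓘(ℝ, B) 𝓘(ℝ) ∞ (fun q => S.H ⟨q, α q⟩) := by
  have h1 : (fun q => S.H ⟨q, α q⟩) = fun q => 1 / 2 * α q (S.zeta α q) + S.potential q := by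
    ext q
    have h2 := (S.exists_zeta α).choose_spec.1 q
    rw [H, cometric, ← kerFlat_apply, LinearEquiv.apply_symm_apply, zeta, h2]
  rw [h1]
  intro q
  have h3 := (α.contMDiff q).clm_bundle_apply ((S.zeta α).contMDiff q)
  rw [contMDiffAt_section] at h3
  have h4 : ContMDiffAt 𝓘(ℝ, B) 𝓘(ℝ) ∞ (fun q => α q (S.zeta α q)) q := h3
  exact (contMDiffAt_const.mul h4).add (S.potential.contMDiff q)

/-- The map `h : V* → E*` with `h(η) = η` on `V` and `h(η)(𝒳) = -H(η)`. -/
def h (η : S.VDual) : TotalSpace (F →L[ℝ] ℝ) (fun q => E q →L[ℝ] ℝ) :=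
  ⟨η.1, η.2.comp (S.pr η.1) - S.H η • S.φ.form η.1⟩

theorem h_incl (η : S.VDual) (v : S.φ.Ker η.1) : (S.h η).2 (S.φ.incl η.1 v) = η.2 v := by
  change η.2 (S.pr η.1 (S.φ.incl η.1 v)) - S.H η • S.φ.form η.1 (S.φ.incl η.1 v) = _
  rw [pr_incl, form_incl]; simp

theorem h_X (η : S.VDual) : (S.h η).2 (S.X η.1) = - S.H η := by
  change η.2 (S.pr η.1 (S.X η.1)) - S.H η • S.φ.form η.1 (S.X η.1) = _
  rw [pr_X, form_X]; simp

/-- The section `h ∘ α` of `E*`. -/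
def hSec (α : DualSec B (KerModel F) S.φ.Ker) : DualSec B F E :=
  ⟨fun q => (S.h ⟨q, α q⟩).2, fun q => ((S.extend α).contMDiff q).sub_section
    ((S.contMDiff_H α q).smul_section (S.φ.form.contMDiff q))⟩

/-- The projection `μ : E* → V*`, the dual of the inclusion of `V`. -/
def μ (a : TotalSpace (F →L[ℝ] ℝ) (fun q => E q →L[ℝ] ℝ)) : S.VDual :=
  ⟨a.1, a.2.comp (S.φ.incl a.1)⟩

theorem μ_h (η : S.VDual) : S.μ (S.h η) = η := by
  obtain ⟨q, η⟩ := η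
  change (⟨q, _⟩ : S.VDual) = ⟨q, η⟩
  congr 1
  ext v
  exact S.h_incl ⟨q, η⟩ v

/-- The function `F_h` on `E*` which is characterised by `a - h(μ(a)) = F_h(a) φ`, see `sub_h`. -/
def Fh (a : TotalSpace (F →L[ℝ] ℝ) (fun q => E q →L[ℝ] ℝ)) : ℝ :=
  a.2 (S.X a.1) + S.H (S.μ a)

theorem sub_h (a : TotalSpace (F →L[ℝ] ℝ) (fun q => E q →L[ℝ] ℝ)) :
    a.2 - (show E a.1 →L[ℝ] ℝ from (S.h (S.μ a)).2) = S.Fh a • S.φ.form a.1 := by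
  ext v
  change a.2 v - (a.2 (S.φ.incl a.1 (S.pr a.1 v)) - S.H (S.μ a) * S.φ.form a.1 v) =
    (a.2 (S.X a.1) + S.H (S.μ a)) * S.φ.form a.1 v
  rw [incl_pr, map_sub, map_smul, smul_eq_mul]
  ring

end MechanicalSystem

end mechanical

section extension
variable [FiniteDimensional ℝ B] [T2Space Q] [IsManifold 𝓘(ℝ, B) ∞ Q]

theorem exists_bump {q : Q} {s : Set Q} (hs : s ∈ 𝓝 q) : ∃ χ : C^∞⟮𝓘(ℝ, B), Q; 𝓘(ℝ), ℝ⟯,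
    (∀ᶠ x in 𝓝 q, χ x = 1) ∧ tsupport χ ⊆ s := by
  obtain ⟨f, -, hf⟩ := (SmoothBumpFunction.nhds_basis_tsupport (I := 𝓘(ℝ, B)) q).mem_iff.1 hs
  exact ⟨⟨f, f.contMDiff⟩, f.eventuallyEq_one, hf⟩

variable [ContMDiffVectorBundle ∞ F E 𝓘(ℝ, B)]

variable (B F E) in
theorem exists_ext (q : Q) : ∃ (χ : C^∞⟮𝓘(ℝ, B), Q; 𝓘(ℝ), ℝ⟯) (e : F →ₗ[ℝ] Sec B F E),
    (∀ᶠ x in 𝓝 q, χ x = 1) ∧ tsupport χ ⊆ (trivializationAt F E q).baseSet ∧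
    ∀ v x, e v x = χ x • (trivializationAt F E q).symmL ℝ x v := by
  have hb := (trivializationAt F E q).open_baseSet
  obtain ⟨χ, h1, h2⟩ := exists_bump (B := B)
    (hb.mem_nhds (FiberBundle.mem_baseSet_trivializationAt' q))
  refine ⟨χ,
    { toFun := fun v => ⟨fun x => χ x • (trivializationAt F E q).symmL ℝ x v,
        ContMDiffOn.smul_section_of_tsupport χ.contMDiff.contMDiffOn hb h2 fun x hx =>
          (NowhereZero.contMDiffAt_symmL_const hx v).contMDiffWithinAt⟩
      map_add' := fun v w => ContMDiffSection.ext fun x => ?_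
      map_smul' := fun c v => ContMDiffSection.ext fun x => ?_ }, h1, h2, fun v x => rfl⟩
  · change χ x • (trivializationAt F E q).symmL ℝ x (v + w) =
      χ x • (trivializationAt F E q).symmL ℝ x v + χ x • (trivializationAt F E q).symmL ℝ x w
    rw [map_add, smul_add]
  · change χ x • (trivializationAt F E q).symmL ℝ x (c • v) =
      c • (χ x • (trivializationAt F E q).symmL ℝ x v)
    rw [map_smul, smul_comm]

variable (B F E) in
theorem exists_ext_fibre (q : Q) : ∃ e : E q →ₗ[ℝ] Sec B F E, ∀ v, e v q = v := by
  obtain ⟨χ, e, h1, -, h3⟩ := exists_ext B F E q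
  refine ⟨e.comp ((trivializationAt F E q).linearMapAt ℝ q), fun v => ?_⟩
  rw [LinearMap.comp_apply, h3, h1.self_of_nhds, one_smul]
  exact Trivialization.symmL_continuousLinearMapAt _ (FiberBundle.mem_baseSet_trivializationAt' q) v

end extension

section smooth
variable [FiniteDimensional ℝ F] [ContMDiffVectorBundle ∞ F E 𝓘(ℝ, B)]
theorem contMDiff_pair (α : DualSec B F E) (σ : Sec B F E) :
    ContMDiff 𝓘(ℝ, B) 𝓘(ℝ) ∞ (fun x => α x (σ x)) := fun q => by
  have h3 := (α.contMDiff q).clm_bundle_apply (σ.contMDiff q)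
  rw [contMDiffAt_section] at h3
  exact h3
end smooth

theorem dirDeriv_add {q : Q} (v : TangentSpace 𝓘(ℝ, B) q) {f g : Q → ℝ}
    (hf : MDifferentiableAt 𝓘(ℝ, B) 𝓘(ℝ) f q) (hg : MDifferentiableAt 𝓘(ℝ, B) 𝓘(ℝ) g q) :
    dirDeriv B v (fun x => f x + g x) = dirDeriv B v f + dirDeriv B v g := by
  have h := (hf.hasMFDerivAt.add hg.hasMFDerivAt).mfderiv
  have h2 : mfderiv 𝓘(ℝ, B) 𝓘(ℝ) (fun x => f x + g x) q = _ := h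
  rw [dirDeriv, h2]; rfl

theorem dirDeriv_mul {q : Q} (v : TangentSpace 𝓘(ℝ, B) q) {f g : Q → ℝ}
    (hf : MDifferentiableAt 𝓘(ℝ, B) 𝓘(ℝ) f q) (hg : MDifferentiableAt 𝓘(ℝ, B) 𝓘(ℝ) g q) :
    dirDeriv B v (fun x => f x * g x) = f q * dirDeriv B v g + g q * dirDeriv B v f := by
  have h := (hf.hasMFDerivAt.mul hg.hasMFDerivAt).mfderiv
  have h2 : mfderiv 𝓘(ℝ, B) 𝓘(ℝ) (fun x => f x * g x) q = _ := h
  rw [dirDeriv, h2]; rfl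

theorem dirDeriv_congr {q : Q} (v : TangentSpace 𝓘(ℝ, B) q) {f g : Q → ℝ}
    (h : ∀ᶠ x in 𝓝 q, f x = g x) : dirDeriv B v f = dirDeriv B v g := by
  have h1 : f =ᶠ[𝓝 q] g := h
  rw [dirDeriv, dirDeriv, h1.mfderiv_eq]; rfl

theorem dirDeriv_const {q : Q} (v : TangentSpace 𝓘(ℝ, B) q) (c : ℝ) :
    dirDeriv B v (fun _ : Q => c) = 0 := by
  simp [dirDeriv, mfderiv_const]; rfl

namespace SkewAlgebroid
variable [IsManifold 𝓘(ℝ, B) ∞ Q] [FiniteDimensional ℝ F] [ContMDiffVectorBundle ∞ F E 𝓘(ℝ, B)]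
variable (A : SkewAlgebroid B F E)

theorem d_skew (α : DualSec B F E) (σ γ : Sec B F E) (q : Q) :
    A.d α σ γ q = - A.d α γ σ q := by
  have h : A.bracket σ γ q = - A.bracket γ σ q := DFunLike.congr_fun (A.skew σ γ) q
  rw [d, d, h, map_neg]; ring

theorem d_add (α : DualSec B F E) (σ γ τ : Sec B F E) (q : Q) :
    A.d α σ (γ + τ) q = A.d α σ γ q + A.d α σ τ q := by
  have h1 : A.bracket σ (γ + τ) q = A.bracket σ γ q + A.bracket σ τ q := by
    rw [map_add]; rfl
  have h2 : (fun x => α x ((γ + τ) x)) = fun x => α x (γ x) + α x (τ x) :=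
    funext fun x => map_add (α x) (γ x) (τ x)
  have h3 : A.anchor q ((γ + τ) q) = A.anchor q (γ q) + A.anchor q (τ q) :=
    map_add (A.anchor q) (γ q) (τ q)
  have h4 : ∀ (v w : TangentSpace 𝓘(ℝ, B) q) (f : Q → ℝ), dirDeriv B (v + w) f =
    dirDeriv B v f + dirDeriv B w f := fun v w f => map_add (mfderiv 𝓘(ℝ, B) 𝓘(ℝ) f q) v w
  rw [d, d, d, h1, h2, h3, h4, dirDeriv_add _ ((contMDiff_pair α γ).mdifferentiable (by simp) q)
    ((contMDiff_pair α τ).mdifferentiable (by simp) q), map_add]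
  ring

theorem d_smul (α : DualSec B F E) (σ γ : Sec B F E) (f : C^∞⟮𝓘(ℝ, B), Q; 𝓘(ℝ), ℝ⟯) (q : Q) :
    A.d α σ (smulSec f γ) q = f q * A.d α σ γ q := by
  have h2 : (fun x => α x (smulSec f γ x)) = fun x => f x * α x (γ x) :=
    funext fun x => map_smul (α x) (f x) (γ x)
  have h3 : A.anchor q (smulSec f γ q) = f q • A.anchor q (γ q) :=
    map_smul (A.anchor q) (f q) (γ q)
  have h4 : ∀ (v : TangentSpace 𝓘(ℝ, B) q) (c : ℝ) (f : Q → ℝ), dirDeriv B (c • v) f =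
    c * dirDeriv B v f := fun v c f => map_smul (mfderiv 𝓘(ℝ, B) 𝓘(ℝ) f q) c v
  rw [d, d, A.leibniz, h2, h3, h4, dirDeriv_mul _ (f.contMDiff.mdifferentiable (by simp) q)
    ((contMDiff_pair α γ).mdifferentiable (by simp) q), map_add, map_smul, map_smul]
  simp only [smul_eq_mul]
  ring

theorem d_sum (α : DualSec B F E) (σ : Sec B F E) {ι : Type*} (s : Finset ι) (γ : ι → Sec B F E)
    (q : Q) : A.d α σ (∑ i ∈ s, γ i) q = ∑ i ∈ s, A.d α σ (γ i) q :=
  map_sum (AddMonoidHom.mk' (fun γ => A.d α σ γ q) (fun γ τ => A.d_add α σ γ τ q)) γ s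

theorem d_sub (α : DualSec B F E) (σ γ τ : Sec B F E) (q : Q) :
    A.d α σ (γ - τ) q = A.d α σ γ q - A.d α σ τ q :=
  map_sub (AddMonoidHom.mk' (fun γ => A.d α σ γ q) (fun γ τ => A.d_add α σ γ τ q)) γ τ

theorem d_const_smul (α : DualSec B F E) (σ γ : Sec B F E) (c : ℝ) (q : Q) :
    A.d α σ (c • γ) q = c * A.d α σ γ q :=
  A.d_smul α σ γ ⟨fun _ => c, contMDiff_const⟩ q

variable [FiniteDimensional ℝ B] [T2Space Q]

theorem d_eq_zero (α : DualSec B F E) (σ γ : Sec B F E) (q : Q) (h : γ q = 0) :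
    A.d α σ γ q = 0 := by
  obtain ⟨χ, e, h1, h2, h3⟩ := exists_ext B F E q
  set t := trivializationAt F E q
  let b := Module.finBasis ℝ F
  have hc : ∀ i, ContMDiff 𝓘(ℝ, B) 𝓘(ℝ) ∞ (fun x => χ x • b.coord i (t ⟨x, γ x⟩).2) := by
    intro i
    refine contMDiff_of_tsupport fun x hx => ?_
    have hx' : x ∈ t.baseSet := h2 (tsupport_smul_subset_left _ _ hx)
    have h4 := (t.contMDiffAt_section_iff (IB := 𝓘(ℝ, B)) (n := ∞) (s := fun x => γ x) hx').1
      (γ.contMDiff x)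
    have h5 : ContMDiffAt 𝓘(ℝ, B) 𝓘(ℝ) ∞ (fun x => b.coord i (t ⟨x, γ x⟩).2) x :=
      ((b.coord i).toContinuousLinearMap.contMDiff (n := ∞)).contMDiffAt.comp x h4
    exact (χ.contMDiff x).smul h5
  obtain ⟨f, hf⟩ : ∃ f : Fin (finrank ℝ F) → C^∞⟮𝓘(ℝ, B), Q; 𝓘(ℝ), ℝ⟯,
      ∀ i x, f i x = χ x • b.coord i (t ⟨x, γ x⟩).2 := ⟨fun i => ⟨_, hc i⟩, fun i x => rfl⟩
  have h6 : smulSec χ (smulSec χ γ) = ∑ i, smulSec (f i) (e (b i)) := by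
    refine ContMDiffSection.ext fun x => ?_
    have h7 : (∑ i, smulSec (f i) (e (b i)) : Sec B F E) x =
        ∑ i, smulSec (f i) (e (b i)) x := by
      exact map_sum (AddMonoidHom.mk' (fun s : Sec B F E => s x) (fun _ _ => rfl)) _ _
    rw [h7]
    change χ x • χ x • γ x = ∑ i, f i x • e (b i) x
    simp only [hf]
    by_cases hx : χ x = 0
    · simp [hx]
    have hx' : x ∈ t.baseSet := h2 (subset_tsupport _ hx)
    have h8 : ∀ i, (χ x • b.coord i (t ⟨x, γ x⟩).2) • e (b i) x =
        χ x • χ x • t.symmL ℝ x (b.coord i (t ⟨x, γ x⟩).2 • b i) := by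
      intro i
      rw [h3, map_smul, smul_assoc]
      congr 1
      rw [smul_comm]
    rw [Finset.sum_congr rfl fun i _ => h8 i, ← Finset.smul_sum, ← Finset.smul_sum, ← map_sum]
    congr 2
    have h9 : ∑ i, b.coord i (t ⟨x, γ x⟩).2 • b i = (t ⟨x, γ x⟩).2 := b.sum_repr _
    rw [h9]
    have h10 := t.symmL_continuousLinearMapAt (R := ℝ) hx' (γ x)
    rw [Trivialization.continuousLinearMapAt_apply, Trivialization.linearMapAt_apply,
      if_pos hx'] at h10
    exact h10.symm
  have h7 := A.d_smul α σ (smulSec χ γ) χ q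
  rw [A.d_smul α σ γ, h6, d_sum, h1.self_of_nhds, one_mul, one_mul] at h7
  rw [← h7]
  refine Finset.sum_eq_zero fun i _ => ?_
  rw [d_smul]
  have hq : q ∈ t.baseSet := FiberBundle.mem_baseSet_trivializationAt' q
  have h11 : (t ⟨q, γ q⟩).2 = 0 := by
    have : t.linearMapAt ℝ q (γ q) = 0 := by rw [h, map_zero]
    rwa [Trivialization.linearMapAt_apply, if_pos hq] at this
  rw [hf, h11]; simp

/-- The almost differential is tensorial. -/
theorem d_congr (α : DualSec B F E) {σ σ' γ γ' : Sec B F E} {q : Q} (h : σ q = σ' q)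
    (h' : γ q = γ' q) : A.d α σ γ q = A.d α σ' γ' q := by
  have h1 : ∀ (σ γ γ' : Sec B F E), γ q = γ' q → A.d α σ γ q = A.d α σ γ' q := by
    intro σ γ γ' h
    have h2 := A.d_eq_zero α σ (γ - γ') q (sub_eq_zero.2 h)
    rw [d_sub] at h2
    linarith
  rw [h1 σ γ γ' h', d_skew, h1 γ' σ σ' h, ← d_skew]

end SkewAlgebroid

variable (F E) in
/-- The total space of the dual bundle `E*`. -/
abbrev DualTot : Type _ := TotalSpace (F →L[ℝ] ℝ) (fun q => E q →L[ℝ] ℝ)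

variable (B) in
/-- The tangent space of the total space of `E*` at `a`. -/
abbrev DualTangent (a : DualTot F E) : Type _ :=
  TangentSpace (𝓘(ℝ, B).prod 𝓘(ℝ, F →L[ℝ] ℝ)) a

variable (B) in
/-- The differential at `a` of a function on the total space of `E*`. -/
def dTot (G : DualTot F E → ℝ) (a : DualTot F E) : DualTangent B a →L[ℝ] ℝ :=
  mfderiv (𝓘(ℝ, B).prod 𝓘(ℝ, F →L[ℝ] ℝ)) 𝓘(ℝ) G a

/-- The fibrewise linear function on `E*` defined by a section of `E`. -/
def hat (σ : Sec B F E) (a : DualTot F E) : ℝ := a.2 (σ a.1)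

/-- `Π` is the value at the point `a` of `E*` of the linear almost Poisson bivector of the
skew-symmetric algebroid structure: the corresponding bracket of functions satisfies
`{σ̂, γ̂} = -[σ, γ]^`, `{f ∘ τ, σ̂} = ρ(σ)(f) ∘ τ` and `{f ∘ τ, g ∘ τ} = 0`, where `τ : E* → Q` is
the projection. (The differentials of the functions `σ̂` and `f ∘ τ` span the cotangent space at
`a`, so that `Π` is unique.) -/
structure IsLinearBivectorAt [IsManifold 𝓘(ℝ, B) ∞ Q] (A : SkewAlgebroid B F E) (a : DualTot F E)
    (P : (DualTangent B a →L[ℝ] ℝ) →ₗ[ℝ] (DualTangent B a →L[ℝ] ℝ) →ₗ[ℝ] ℝ) : Prop where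
  skew : ∀ θ θ', P θ θ' = - P θ' θ
  hat_hat : ∀ σ γ : Sec B F E, P (dTot B (hat σ) a) (dTot B (hat γ) a) = - hat (A.bracket σ γ) a
  base_hat : ∀ (f : C^∞⟮𝓘(ℝ, B), Q; 𝓘(ℝ), ℝ⟯) (σ : Sec B F E),
    P (dTot B (fun b => f b.1) a) (dTot B (hat σ) a) = dirDeriv B (A.anchor a.1 (σ a.1)) f
  base_base : ∀ f g : C^∞⟮𝓘(ℝ, B), Q; 𝓘(ℝ), ℝ⟯,
    P (dTot B (fun b => f b.1) a) (dTot B (fun b => g b.1) a) = 0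

section existence
variable [FiniteDimensional ℝ F] [ContMDiffVectorBundle ∞ F E 𝓘(ℝ, B)]

theorem contMDiff_hat (σ : Sec B F E) :
    ContMDiff (𝓘(ℝ, B).prod 𝓘(ℝ, F →L[ℝ] ℝ)) 𝓘(ℝ) ∞ (hat σ : DualTot F E → ℝ) := fun a => by
  have h1 : ContMDiffAt (𝓘(ℝ, B).prod 𝓘(ℝ, F →L[ℝ] ℝ)) (𝓘(ℝ, B).prod 𝓘(ℝ, F →L[ℝ] ℝ)) ∞
    (fun b : DualTot F E => TotalSpace.mk' (F →L[ℝ] ℝ) (E := fun q => E q →L[ℝ] ℝ) b.1 b.2) a :=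
    contMDiffAt_id
  have h2 : ContMDiffAt (𝓘(ℝ, B).prod 𝓘(ℝ, F →L[ℝ] ℝ)) (𝓘(ℝ, B).prod 𝓘(ℝ, F)) ∞
    (fun b : DualTot F E => TotalSpace.mk' F (E := E) b.1 (σ b.1)) a :=
    (σ.contMDiff a.1).comp a (contMDiffAt_proj _)
  have h3 := ContMDiffAt.clm_bundle_apply (F₂ := ℝ) (E₂ := fun _ : Q => ℝ)
    (b := fun b : DualTot F E => b.1) (ϕ := fun b : DualTot F E => b.2) h1 h2
  rw [contMDiffAt_totalSpace] at h3
  exact h3.2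

/-- The inclusion of the fibre over `q`, in the coordinates of a trivialisation. -/
def fibreMap (q : Q) (c : F →L[ℝ] ℝ) : DualTot F E :=
  ⟨q, (trivializationAt (F →L[ℝ] ℝ) (fun q => E q →L[ℝ] ℝ) q).symmL ℝ q c⟩

theorem contMDiff_fibreMap (q : Q) : ContMDiff 𝓘(ℝ, F →L[ℝ] ℝ) (𝓘(ℝ, B).prod 𝓘(ℝ, F →L[ℝ] ℝ)) ∞
    (fibreMap q : (F →L[ℝ] ℝ) → DualTot F E) := fun c => by
  have hq := FiberBundle.mem_baseSet_trivializationAt' (F := F →L[ℝ] ℝ)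
    (E := fun q => E q →L[ℝ] ℝ) q
  rw [contMDiffAt_totalSpace]
  refine ⟨contMDiffAt_const, contMDiffAt_id.congr_of_eventuallyEq (.of_forall fun c => ?_)⟩
  simp only [fibreMap]
  rw [Trivialization.symmL_apply _ hq, Trivialization.apply_mk_symm _ hq]
  rfl

theorem exists_evaluation {W Z : Type*} [AddCommGroup W] [Module ℝ W] [TopologicalSpace W]
    [IsTopologicalAddGroup W] [ContinuousSMul ℝ W] [T2Space W] [FiniteDimensional ℝ W]
    [NormedAddCommGroup Z] [NormedSpace ℝ Z] [FiniteDimensional ℝ Z]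
    (j : Z →ₗ[ℝ] (W →L[ℝ] ℝ)) (hj : Function.Surjective j) :
    ∃ D : (Z →L[ℝ] ℝ) →ₗ[ℝ] W, ∀ v θ, (∀ c, θ c = j c v) → D θ = v := by
  let ev : W →ₗ[ℝ] (Z →L[ℝ] ℝ) :=
    { toFun := fun v => LinearMap.toContinuousLinearMap
        { toFun := fun c => j c v
          map_add' := fun c c' => by rw [map_add]; rfl
          map_smul' := fun r c => by rw [map_smul]; rfl }
      map_add' := fun v w => by ext c; exact map_add (j c) v w
      map_smul' := fun r v => by ext c; exact map_smul (j c) r v }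
  have hev : ∀ v c, ev v c = j c v := fun v c => rfl
  have hinj : LinearMap.ker ev = ⊥ := by
    rw [LinearMap.ker_eq_bot']
    intro v hv
    rw [← Module.forall_dual_apply_eq_zero_iff ℝ v]
    intro f
    obtain ⟨c, hc⟩ := hj (LinearMap.toContinuousLinearMap f)
    have h1 := hev v c
    rw [hv, hc] at h1
    exact h1.symm
  obtain ⟨D, hD⟩ := ev.exists_leftInverse_of_injective hinj
  refine ⟨D, fun v θ h => ?_⟩
  have h1 : θ = ev v := ContinuousLinearMap.ext h
  rw [h1]
  exact LinearMap.congr_fun hD v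

theorem exists_bilinear {W V : Type*} [AddCommGroup W] [Module ℝ W] [TopologicalSpace W]
    [IsTopologicalAddGroup W] [ContinuousSMul ℝ W] [AddCommGroup V] [Module ℝ V]
    (s : (W →L[ℝ] ℝ) →ₗ[ℝ] V) (κ : V →ₗ[ℝ] W) (δ : V →ₗ[ℝ] V →ₗ[ℝ] ℝ) :
    ∃ P : (W →L[ℝ] ℝ) →ₗ[ℝ] (W →L[ℝ] ℝ) →ₗ[ℝ] ℝ,
      ∀ θ θ', P θ θ' = θ (κ (s θ')) - θ' (κ (s θ)) + δ (s θ) (s θ') := by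
  refine ⟨LinearMap.mk₂ ℝ (fun θ θ' => θ (κ (s θ')) - θ' (κ (s θ)) + δ (s θ) (s θ'))
    ?_ ?_ ?_ ?_, fun θ θ' => rfl⟩
  · intro θ θ' τ
    simp only [map_add, add_apply, LinearMap.add_apply]; ring
  · intro r θ τ
    simp only [map_smul, smul_apply, LinearMap.smul_apply, smul_eq_mul]; ring
  · intro θ τ τ'
    simp only [map_add, add_apply]; ring
  · intro r θ τ
    simp only [map_smul, smul_apply, smul_eq_mul]; ring

theorem exists_bivector [FiniteDimensional ℝ B] [T2Space Q] [IsManifold 𝓘(ℝ, B) ∞ Q]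
    (A : SkewAlgebroid B F E) (a : DualTot F E) : ∃ P, IsLinearBivectorAt A a P := by
  obtain ⟨q, a⟩ := a
  obtain ⟨ext, hext⟩ := exists_ext_fibre B F E q
  obtain ⟨β, hβ⟩ : ∃ β : DualSec B F E, β q = a := by
    obtain ⟨e, he⟩ := exists_ext_fibre B (F →L[ℝ] ℝ) (fun q => E q →L[ℝ] ℝ) q
    exact ⟨e a, he a⟩
  subst hβ
  set t := trivializationAt (F →L[ℝ] ℝ) (fun q => E q →L[ℝ] ℝ) q with ht
  have hq : q ∈ t.baseSet := FiberBundle.mem_baseSet_trivializationAt' q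
  have := FiberBundle.t2Space F E q
  have := VectorBundle.finiteDimensional ℝ F E q
  have := (VectorBundle.continuousLinearEquivAt ℝ F E q).toContinuousAddEquiv.isTopologicalAddGroup
  have := (VectorBundle.continuousLinearEquivAt ℝ F E q).continuousSMul
  obtain ⟨D, hD⟩ := exists_evaluation (t.symmL ℝ q : (F →L[ℝ] ℝ) →ₗ[ℝ] (E q →L[ℝ] ℝ))
    fun f => ⟨t.continuousLinearMapAt ℝ q f, t.symmL_continuousLinearMapAt hq f⟩
  -- the horizontal and the vertical part of a covector
  let b : Q → DualTot F E := fun x => ⟨x, β x⟩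
  have hb : MDifferentiableAt 𝓘(ℝ, B) (𝓘(ℝ, B).prod 𝓘(ℝ, F →L[ℝ] ℝ)) b q :=
    β.contMDiff.mdifferentiable (by simp) q
  let c₀ := t.continuousLinearMapAt ℝ q (β q)
  have hc₀ : (fibreMap q c₀ : DualTot F E) = b q := by
    change (⟨q, t.symmL ℝ q (t.continuousLinearMapAt ℝ q (β q))⟩ : DualTot F E) = ⟨q, β q⟩
    rw [t.symmL_continuousLinearMapAt hq]
  let Tb : TangentSpace 𝓘(ℝ, B) q →L[ℝ] DualTangent B (b q) :=
    mfderiv 𝓘(ℝ, B) (𝓘(ℝ, B).prod 𝓘(ℝ, F →L[ℝ] ℝ)) b q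
  let Tf : (F →L[ℝ] ℝ) →L[ℝ] DualTangent B (b q) :=
    mfderiv 𝓘(ℝ, F →L[ℝ] ℝ) (𝓘(ℝ, B).prod 𝓘(ℝ, F →L[ℝ] ℝ))
      (fibreMap q : (F →L[ℝ] ℝ) → DualTot F E) c₀
  let s : (DualTangent B (b q) →L[ℝ] ℝ) →ₗ[ℝ] E q :=
    { toFun := fun θ => D (θ.comp Tf)
      map_add' := fun θ θ' => by rw [ContinuousLinearMap.add_comp, map_add]
      map_smul' := fun r θ => by rw [ContinuousLinearMap.smul_comp, map_smul]; rfl }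
  have hTb : ∀ G : DualTot F E → ℝ, MDifferentiableAt (𝓘(ℝ, B).prod 𝓘(ℝ, F →L[ℝ] ℝ)) 𝓘(ℝ) G (b q) →
      ∀ u, dTot B G (b q) (Tb u) = dirDeriv B u (fun x => G (b x)) := fun G hG u =>
    (mfderiv_comp_apply q hG hb u).symm
  have hTf : ∀ G : DualTot F E → ℝ, MDifferentiableAt (𝓘(ℝ, B).prod 𝓘(ℝ, F →L[ℝ] ℝ)) 𝓘(ℝ) G (b q) →
      ∀ L : (F →L[ℝ] ℝ) →L[ℝ] ℝ, ∀ r : ℝ, (∀ c, G (fibreMap q c : DualTot F E) = L c + r) →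
      (dTot B G (b q)).comp Tf = L := by
    intro G hG L r h
    have hf := (contMDiff_fibreMap (B := B) (E := E) q).mdifferentiable (by simp) c₀
    have h2 : (G ∘ fibreMap q : (F →L[ℝ] ℝ) → ℝ) = fun c => L c + r := funext h
    have h3 : fderiv ℝ (fun c => L c + r) c₀ = L := by
      rw [fderiv_add_const]; exact L.fderiv
    ext v
    have h1 := mfderiv_comp_apply_of_eq c₀ hG hf hc₀ v
    rw [h2, mfderiv_eq_fderiv, h3] at h1
    exact h1.symm
  have hhat : ∀ σ : Sec B F E, MDifferentiableAt (𝓘(ℝ, B).prod 𝓘(ℝ, F →L[ℝ] ℝ)) 𝓘(ℝ)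
      (hat σ : DualTot F E → ℝ) (b q) := fun σ => (contMDiff_hat σ).mdifferentiable (by simp) _
  have hbase : ∀ f : C^∞⟮𝓘(ℝ, B), Q; 𝓘(ℝ), ℝ⟯, MDifferentiableAt (𝓘(ℝ, B).prod 𝓘(ℝ, F →L[ℝ] ℝ))
      𝓘(ℝ) (fun b : DualTot F E => f b.1) (b q) := fun f =>
    (f.contMDiff.comp (contMDiff_proj _)).mdifferentiable (by simp) _
  have hs : ∀ σ : Sec B F E, s (dTot B (hat σ) (b q)) = σ q := by
    intro σ
    change D ((dTot B (hat σ) (b q)).comp Tf) = _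
    let L : (F →L[ℝ] ℝ) →L[ℝ] ℝ := LinearMap.toContinuousLinearMap
      { toFun := fun c => t.symmL ℝ q c (σ q)
        map_add' := fun c c' => by rw [map_add]; rfl
        map_smul' := fun r c => by rw [map_smul]; rfl }
    rw [hTf _ (hhat σ) L 0 fun c => (add_zero _).symm]
    exact hD _ _ fun c => rfl
  have hs0 : ∀ f : C^∞⟮𝓘(ℝ, B), Q; 𝓘(ℝ), ℝ⟯, s (dTot B (fun b => f b.1) (b q)) = 0 := by
    intro f
    change D ((dTot B (fun b => f b.1) (b q)).comp Tf) = _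
    rw [hTf _ (hbase f) 0 (f q) fun c => (zero_add _).symm, map_zero]
  let δ : E q →ₗ[ℝ] E q →ₗ[ℝ] ℝ := LinearMap.mk₂ ℝ (fun v w => A.d β (ext v) (ext w) q)
    (fun v v' w => by
      rw [A.d_skew, map_add, A.d_add, A.d_skew β (ext v), A.d_skew β (ext v')]; ring)
    (fun r v w => by
      rw [A.d_skew, map_smul, A.d_const_smul, A.d_skew β (ext v), smul_eq_mul]; ring)
    (fun v w w' => by rw [map_add, A.d_add])
    (fun r v w => by rw [map_smul, A.d_const_smul, smul_eq_mul])
  have hδ : ∀ v w, δ v w = A.d β (ext v) (ext w) q := fun v w => rfl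
  obtain ⟨P, hP⟩ := exists_bilinear s
    (Tb.toLinearMap.comp (A.anchor q : E q →ₗ[ℝ] TangentSpace 𝓘(ℝ, B) q)) δ
  have hP' : ∀ θ θ', P θ θ' = θ (Tb (A.anchor q (s θ'))) - θ' (Tb (A.anchor q (s θ))) +
    A.d β (ext (s θ)) (ext (s θ')) q := hP
  refine ⟨P, ⟨fun θ θ' => ?_, fun σ γ => ?_, fun f σ => ?_, fun f g => ?_⟩⟩
  · rw [hP', hP', A.d_skew]; ring
  · rw [hP', hs, hs, hTb _ (hhat σ), hTb _ (hhat γ), A.d_congr β (hext (σ q)) (hext (γ q))]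
    simp only [SkewAlgebroid.d, hat, b]
    ring
  · have h0 : (dTot B (hat σ) (b q)) (Tb (A.anchor q 0)) = 0 := by
      rw [hTb _ (hhat σ), map_zero]
      exact map_zero (mfderiv 𝓘(ℝ, B) 𝓘(ℝ) (fun x => hat σ (b x)) q)
    rw [hP', ← hδ, hs, hs0, hTb _ (hbase f), h0, map_zero, LinearMap.zero_apply, sub_zero, add_zero]
  · have h0 : ∀ f : C^∞⟮𝓘(ℝ, B), Q; 𝓘(ℝ), ℝ⟯,
        (dTot B (fun b : DualTot F E => f b.1) (b q)) (Tb (A.anchor q 0)) = 0 := by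
      intro f
      rw [hTb _ (hbase f), map_zero]
      exact map_zero (mfderiv 𝓘(ℝ, B) 𝓘(ℝ) (fun x => f (b x).1) q)
    rw [hP', ← hδ, hs0, hs0, h0, h0, map_zero, sub_zero, add_zero]

end existence

section hamiltonian
variable [FiniteDimensional ℝ F] [ContMDiffVectorBundle ∞ F E 𝓘(ℝ, B)]
  [FiniteDimensional ℝ B] [T2Space Q] [IsManifold 𝓘(ℝ, B) ∞ Q]

theorem exists_vector_eq {W : Type*} [NormedAddCommGroup W] [NormedSpace ℝ W]
    [FiniteDimensional ℝ W] (l : (W →L[ℝ] ℝ) →ₗ[ℝ] ℝ) : ∃ w : W, ∀ θ : W →L[ℝ] ℝ, θ w = l θ := by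
  obtain ⟨w, hw⟩ := (Module.evalEquiv ℝ W).surjective
    (l.comp (LinearMap.toContinuousLinearMap (E := W) (F' := ℝ)).toLinearMap)
  refine ⟨w, fun θ => ?_⟩
  have h := LinearMap.congr_fun hw (θ : W →ₗ[ℝ] ℝ)
  exact h

namespace SkewAlgebroid
variable (A : SkewAlgebroid B F E)

/-- The linear almost Poisson bivector on `E*`. -/
def bivector (a : DualTot F E) :
    (DualTangent B a →L[ℝ] ℝ) →ₗ[ℝ] (DualTangent B a →L[ℝ] ℝ) →ₗ[ℝ] ℝ :=
  (exists_bivector A a).choose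

theorem isLinearBivectorAt_bivector (a : DualTot F E) : IsLinearBivectorAt A a (A.bivector a) :=
  (exists_bivector A a).choose_spec

theorem exists_hamiltonian (G : DualTot F E → ℝ) (a : DualTot F E) :
    ∃ w : DualTangent B a, ∀ θ : DualTangent B a →L[ℝ] ℝ, θ w = A.bivector a θ (dTot B G a) :=
  exists_vector_eq (W := B × (F →L[ℝ] ℝ)) ((A.bivector a).flip (dTot B G a))

/-- The Hamiltonian vector field of a function `G` on `E*`: `θ(H_G) = Π(θ, dG)` for every covector
`θ`, that is, `H_G = -i_{dG} Π`. -/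
def hamiltonian (G : DualTot F E → ℝ) (a : DualTot F E) : DualTangent B a :=
  (A.exists_hamiltonian G a).choose

theorem apply_hamiltonian (G : DualTot F E → ℝ) (a : DualTot F E)
    (θ : DualTangent B a →L[ℝ] ℝ) : θ (A.hamiltonian G a) = A.bivector a θ (dTot B G a) :=
  (A.exists_hamiltonian G a).choose_spec θ

end SkewAlgebroid

namespace MechanicalSystem
open NowhereZero
variable (S : MechanicalSystem B F E)

/-- The vector field `R_h` on `V*`, which is the projection by `μ` of the Hamiltonian vector field
of `F_h`, that is, `R_h ∘ μ = Tμ ∘ H_{F_h}`. It is evaluated along `h`, since `μ ∘ h = id`. -/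
def R (η : S.VDual) : TangentSpace (𝓘(ℝ, B).prod 𝓘(ℝ, KerModel F →L[ℝ] ℝ)) η :=
  mfderiv (𝓘(ℝ, B).prod 𝓘(ℝ, F →L[ℝ] ℝ)) (𝓘(ℝ, B).prod 𝓘(ℝ, KerModel F →L[ℝ] ℝ)) S.μ (S.h η)
    (S.algebroid.hamiltonian S.Fh (S.h η))

/-- The vector field `R_h^α = Tτ ∘ R_h ∘ α` on `Q`, where `τ : V* → Q` is the projection. -/
def Rα (α : DualSec B (KerModel F) S.φ.Ker) (q : Q) : TangentSpace 𝓘(ℝ, B) q :=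
  mfderiv (𝓘(ℝ, B).prod 𝓘(ℝ, KerModel F →L[ℝ] ℝ)) 𝓘(ℝ, B) (fun η : S.VDual => η.1) ⟨q, α q⟩
    (S.R ⟨q, α q⟩)

end MechanicalSystem
end hamiltonian

end
end HJ

/-! Condition (i) says that `R_h^α` and `R_h` are α-related: `Tα(R_h^α(q)) = R_h(α(q))` for every
`q`. If they are related, the chain rule carries integral curves to integral curves. Conversely,
`R_h^α` is smooth, so an integral curve passes through every `q`, and comparing the two velocities
of `α ∘ c` at that point gives relatedness there. It remains to identify relatedness with the
Hamilton–Jacobi equation, which `mfderiv_Rα_eq_iff` and `d_velocity` do together.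

A tangent vector of a dual bundle is determined by its action on functions from the base and on
fibrewise linear functions (`dualTangent_ext`). Functions from the base give no condition, because
`R_h^α` is the projection of `R_h`. For a section `γ` of `V`, the function `γ̂ ∘ μ` is the fibrewise
linear function of `γ` viewed in `E`, so `R_h(γ̂)` is its bracket with `F_h`, taken at `h(α(q))`.

To compute that bracket, write `dF_h = d(f ∘ τ) + dσ̂` at the point `h(α(q))`, which is possible
because such covectors span (`exists_covector_eq`). Vertical directions give `σ(q) = 𝒳(q) +
ζ_H^α(q)`. Since `F_h` vanishes on the image of `h`, directions tangent to `h ∘ α` give `df = -d((h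
∘ α)(σ))` at `q` (`exists_dTot_Fh`). The defining brackets of `Π` then yield `R_h(γ̂) = ρ(γ)((h ∘
α)(σ)) + (h ∘ α)([σ, γ]) = ρ(σ)(α(γ)) - d^E(h ∘ α)(σ, γ)`, and `ρ(σ(q)) = R_h^α(q)` (`Rα_eq`,
`dTot_hat_R`). As `Tα(R_h^α)(γ̂) = R_h^α(α(γ))`, the obstruction to relatedness is `d^E(h ∘ α)(𝒳 +
ζ_H^α, γ)`. Its `ζ_H^α` part is `d^V α(ζ_H^α, γ)`, because `h ∘ α` restricts to `α` on `V` and the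
algebroid of `V` is the restriction of that of `E`. -/

namespace HJ
noncomputable section

/-! ### Differentials in the preferred chart, and smoothness of operator-valued maps -/

section calculus

/-- A function which is linear in the preferred chart at `x` has the expected differential. -/
theorem mfderiv_apply_of_eventuallyEq_extChartAt {W H M : Type*} [NormedAddCommGroup W]
    [NormedSpace ℝ W] [TopologicalSpace H] {I : ModelWithCorners ℝ W H} [TopologicalSpace M]
    [ChartedSpace H M] [IsManifold I 1 M] {x : M} {G : M → ℝ} (L : W →L[ℝ] ℝ)
    (h : ∀ᶠ y in 𝓝 x, G y = L (extChartAt I x y)) (w : TangentSpace I x) :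
    (mfderiv I 𝓘(ℝ) G x w : ℝ) = L (show W from w) := by
  have h1 : G =ᶠ[𝓝 x] L ∘ extChartAt I x := h
  have h2 : mfderiv I 𝓘(ℝ) G x = mfderiv I 𝓘(ℝ) (L ∘ extChartAt I x) x := h1.mfderiv_eq
  have h3 : MDifferentiableAt I 𝓘(ℝ, W) (extChartAt I x) x :=
    mdifferentiableAt_extChartAt (mem_chart_source H x)
  have h4 : MDifferentiableAt 𝓘(ℝ, W) 𝓘(ℝ) L (extChartAt I x x) := L.mdifferentiableAt
  have h5 := mfderiv_comp_apply x h4 h3 w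
  -- The tangent space at `x` is identified with `W` through the preferred chart at `x`, so the
  -- derivative of that chart at its own centre is the identity.
  have h6 : mfderiv I 𝓘(ℝ, W) (extChartAt I x) x w = w := by
    rw [(hasMFDerivAt_extChartAt (mem_chart_source H x)).mfderiv,
      mfderiv_chartAt_eq_tangentCoordChange (mem_chart_source H x)]
    have h := tangentCoordChange_self (I := I) (v := (show W from w)) (mem_extChartAt_source x)
    exact h
  have h7 : mfderiv 𝓘(ℝ, W) 𝓘(ℝ) L (extChartAt I x x) = L := h4.hasMFDerivAt.mfderiv.trans
    L.hasMFDerivAt.mfderiv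
  rw [h6, h7] at h5
  rw [h2]
  exact h5

/-- A basis of the finite-dimensional `F₁` identifies operators with finite families of vectors of
`F₂`. This is `contMDiffAt_clm` for an arbitrary model with corners, so that the source may be the
total space of a bundle. -/
theorem contMDiffAt_clm_of_apply {W H M : Type*} [NormedAddCommGroup W]
    [NormedSpace ℝ W] [TopologicalSpace H] {I : ModelWithCorners ℝ W H} [TopologicalSpace M]
    [ChartedSpace H M] {F₁ F₂ : Type*} [NormedAddCommGroup F₁] [NormedSpace ℝ F₁]
    [FiniteDimensional ℝ F₁] [NormedAddCommGroup F₂] [NormedSpace ℝ F₂] {f : M → F₁ →L[ℝ] F₂}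
    {x : M} (h : ∀ v, ContMDiffAt I 𝓘(ℝ, F₂) ∞ (fun m => f m v) x) :
    ContMDiffAt I 𝓘(ℝ, F₁ →L[ℝ] F₂) ∞ f x := by
  let d := finrank ℝ F₁
  have hd : d = finrank ℝ (Fin d → ℝ) := (finrank_fin_fun ℝ).symm
  let e₁ := ContinuousLinearEquiv.ofFinrankEq hd
  let e₂ := (e₁.arrowCongr (1 : F₂ ≃L[ℝ] F₂)).trans (ContinuousLinearEquiv.piRing (Fin d))
  have h2 : ContMDiffAt I 𝓘(ℝ, Fin d → F₂) ∞ (fun m => e₂ (f m)) x := by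
    rw [contMDiffAt_pi_space]
    intro i
    exact h _
  have h3 : f = fun m => e₂.symm (e₂ (f m)) := by
    ext1 m; simp
  rw [h3]
  exact (e₂.symm : (Fin d → F₂) →L[ℝ] (F₁ →L[ℝ] F₂)).contMDiff.contMDiffAt.comp x h2

end calculus

/-! ### Tangent vectors of the base as derivations -/

variable {B : Type*} [NormedAddCommGroup B] [NormedSpace ℝ B]
  {Q : Type*} [TopologicalSpace Q] [ChartedSpace B Q]
  {F : Type*} [NormedAddCommGroup F] [NormedSpace ℝ F]
  {E : Q → Type*} [TopologicalSpace (TotalSpace F E)] [∀ q, AddCommGroup (E q)]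
  [∀ q, Module ℝ (E q)] [∀ q, TopologicalSpace (E q)]
  [FiberBundle F E] [VectorBundle ℝ F E]
  [FiniteDimensional ℝ B] [T2Space Q] [IsManifold 𝓘(ℝ, B) ∞ Q]

/-- A bump function supported in the chart domain makes local coordinates global, so that
coordinates of tangent vectors can be read off by functions in `C^∞(Q)`. -/
theorem exists_eventually_eq_linear_extChartAt (q : Q) (ℓ : B →L[ℝ] ℝ) :
    ∃ f : C^∞⟮𝓘(ℝ, B), Q; 𝓘(ℝ), ℝ⟯, ∀ᶠ x in 𝓝 q, f x = ℓ (extChartAt 𝓘(ℝ, B) q x) := by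
  have hs : (chartAt B q).source ∈ 𝓝 q := (chartAt B q).open_source.mem_nhds (mem_chart_source B q)
  obtain ⟨χ, h1, h2⟩ := exists_bump (B := B) hs
  refine ⟨⟨fun x => χ x • ℓ (extChartAt 𝓘(ℝ, B) q x), contMDiff_of_tsupport fun x hx => ?_⟩, ?_⟩
  · have hx' : x ∈ (chartAt B q).source := h2 (tsupport_smul_subset_left _ _ hx)
    have h3 : ContMDiffAt 𝓘(ℝ, B) 𝓘(ℝ, B) ∞ (extChartAt 𝓘(ℝ, B) q) x := contMDiffAt_extChartAt' hx'
    exact (χ.contMDiff x).smul ((ℓ.contMDiff (n := ∞)).contMDiffAt.comp x h3)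
  · filter_upwards [h1] with x hx
    change χ x • ℓ (extChartAt 𝓘(ℝ, B) q x) = _
    rw [hx, one_smul]

/-- A tangent vector is determined by its action on smooth functions. -/
theorem tangent_ext {q : Q} {u v : TangentSpace 𝓘(ℝ, B) q}
    (h : ∀ f : C^∞⟮𝓘(ℝ, B), Q; 𝓘(ℝ), ℝ⟯, dirDeriv B u f = dirDeriv B v f) : u = v := by
  have h1 : ∀ ℓ : B →L[ℝ] ℝ, ℓ (show B from u) = ℓ (show B from v) := by
    intro ℓ
    obtain ⟨f, hf⟩ := exists_eventually_eq_linear_extChartAt q ℓ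
    have h2 := h f
    have h3 := mfderiv_apply_of_eventuallyEq_extChartAt ℓ hf
    exact (h3 u).symm.trans (h2.trans (h3 v))
  by_contra hne
  obtain ⟨ℓ, hℓ⟩ := SeparatingDual.exists_separating_of_ne (R := ℝ) (V := B) hne
  exact hℓ (h1 ℓ)

end

/-! ### Basic and fibrewise linear functions as coordinates on the total space of a dual bundle -/

section duals
variable {B : Type*} [NormedAddCommGroup B] [NormedSpace ℝ B]
  {Q : Type*} [TopologicalSpace Q] [ChartedSpace B Q]
  {F : Type*} [NormedAddCommGroup F] [NormedSpace ℝ F]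
  {E : Q → Type*} [TopologicalSpace (TotalSpace F E)] [∀ q, AddCommGroup (E q)]
  [∀ q, Module ℝ (E q)] [∀ q, TopologicalSpace (E q)]
  [FiberBundle F E] [VectorBundle ℝ F E]

/-- The fibre coordinates of a covector are its values on the sections that are constant in the
trivialisation. This is why the functions `hat σ` serve as fibre coordinates. -/
theorem dual_trivializationAt_apply (q : Q) (a : DualTot F E) (v : F) :
    (trivializationAt (F →L[ℝ] ℝ) (fun q => E q →L[ℝ] ℝ) q a).2 v =
      a.2 ((trivializationAt F E q).symmL ℝ a.1 v) := by
  rw [hom_trivializationAt_apply]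
  simp [ContinuousLinearMap.inCoordinates]

theorem extChartAt_dual_fst (a b : DualTot F E) :
    (extChartAt (𝓘(ℝ, B).prod 𝓘(ℝ, F →L[ℝ] ℝ)) a b).1 = extChartAt 𝓘(ℝ, B) a.1 b.1 := by
  rw [FiberBundle.extChartAt]
  rfl

theorem extChartAt_dual_snd (a b : DualTot F E) (v : F) :
    (extChartAt (𝓘(ℝ, B).prod 𝓘(ℝ, F →L[ℝ] ℝ)) a b).2 v =
      b.2 ((trivializationAt F E a.1).symmL ℝ b.1 v) := by
  rw [FiberBundle.extChartAt]
  exact dual_trivializationAt_apply a.1 b v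

variable [FiniteDimensional ℝ B] [T2Space Q] [IsManifold 𝓘(ℝ, B) ∞ Q]
  [ContMDiffVectorBundle ∞ F E 𝓘(ℝ, B)]

variable (B F E) in
/-- There are sections which are constant in a trivialisation near `q`. -/
theorem exists_eventually_eq_symmL (q : Q) (v : F) : ∃ σ : Sec B F E,
    ∀ᶠ x in 𝓝 q, σ x = (trivializationAt F E q).symmL ℝ x v := by
  obtain ⟨χ, e, h1, -, h3⟩ := exists_ext B F E q
  refine ⟨e v, ?_⟩
  filter_upwards [h1] with x hx
  rw [h3, hx, one_smul]

theorem eventually_proj {a : DualTot F E} {p : Q → Prop} (h : ∀ᶠ x in 𝓝 a.1, p x) :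
    ∀ᶠ b : DualTot F E in 𝓝 a, p b.1 :=
  (FiberBundle.continuous_proj (F →L[ℝ] ℝ) fun q => E q →L[ℝ] ℝ).continuousAt.eventually h

/-- The first component of a tangent vector, seen by functions on the base. -/
theorem exists_dTot_base (q : Q) (ℓ : B →L[ℝ] ℝ) : ∃ f : C^∞⟮𝓘(ℝ, B), Q; 𝓘(ℝ), ℝ⟯,
    ∀ (a : E q →L[ℝ] ℝ) (w : DualTangent B (⟨q, a⟩ : DualTot F E)),
      dTot B (fun b : DualTot F E => f b.1) ⟨q, a⟩ w = ℓ (show B × (F →L[ℝ] ℝ) from w).1 := by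
  obtain ⟨f, hf⟩ := exists_eventually_eq_linear_extChartAt q ℓ
  refine ⟨f, fun a w => ?_⟩
  refine mfderiv_apply_of_eventuallyEq_extChartAt (ℓ.comp (ContinuousLinearMap.fst ℝ B
    (F →L[ℝ] ℝ))) ?_ w
  filter_upwards [eventually_proj (a := (⟨q, a⟩ : DualTot F E)) hf] with b hb
  rw [hb]
  exact congrArg ℓ (extChartAt_dual_fst (⟨q, a⟩ : DualTot F E) b).symm

/-- The second component of a tangent vector, seen by fibrewise linear functions. -/
theorem exists_dTot_hat (q : Q) (v : F) : ∃ σ : Sec B F E,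
    ∀ (a : E q →L[ℝ] ℝ) (w : DualTangent B (⟨q, a⟩ : DualTot F E)),
      dTot B (hat σ) ⟨q, a⟩ w = (show B × (F →L[ℝ] ℝ) from w).2 v := by
  obtain ⟨σ, hσ⟩ := exists_eventually_eq_symmL B F E q v
  refine ⟨σ, fun a w => ?_⟩
  refine mfderiv_apply_of_eventuallyEq_extChartAt ((ContinuousLinearMap.apply ℝ ℝ v).comp
    (ContinuousLinearMap.snd ℝ B (F →L[ℝ] ℝ))) ?_ w
  filter_upwards [eventually_proj (a := (⟨q, a⟩ : DualTot F E)) hσ] with b hb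
  have h := extChartAt_dual_snd (B := B) (⟨q, a⟩ : DualTot F E) b v
  rw [← hb] at h
  exact h.symm

/-- A tangent vector of `E*` is determined by its action on basic and fibrewise linear functions. -/
theorem dualTangent_ext {a : DualTot F E} {w w' : DualTangent B a}
    (h : ∀ f : C^∞⟮𝓘(ℝ, B), Q; 𝓘(ℝ), ℝ⟯, dTot B (fun b : DualTot F E => f b.1) a w =
      dTot B (fun b : DualTot F E => f b.1) a w')
    (h' : ∀ σ : Sec B F E, dTot B (hat σ) a w = dTot B (hat σ) a w') : w = w' := by
  obtain ⟨q, a⟩ := a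
  have h1 : (show B × (F →L[ℝ] ℝ) from w).1 = (show B × (F →L[ℝ] ℝ) from w').1 := by
    rw [SeparatingDual.eq_iff_forall_dual_eq (R := ℝ)]
    intro ℓ
    obtain ⟨f, hf⟩ := exists_dTot_base (E := E) (F := F) q ℓ
    rw [← hf a w, ← hf a w', h]
  have h2 : (show B × (F →L[ℝ] ℝ) from w).2 = (show B × (F →L[ℝ] ℝ) from w').2 := by
    ext v
    obtain ⟨σ, hσ⟩ := exists_dTot_hat (B := B) (E := E) q v
    rw [← hσ a w, ← hσ a w', h']
  exact Prod.ext (α := B) (β := F →L[ℝ] ℝ) h1 h2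

/-- The differentials of basic and fibrewise linear functions span the cotangent spaces of `E*`. -/
theorem exists_covector_eq [FiniteDimensional ℝ F] (a : DualTot F E)
    (θ : DualTangent B a →L[ℝ] ℝ) : ∃ (f : C^∞⟮𝓘(ℝ, B), Q; 𝓘(ℝ), ℝ⟯) (σ : Sec B F E),
      θ = dTot B (fun b : DualTot F E => f b.1) a + dTot B (hat σ) a := by
  obtain ⟨q, a⟩ := a
  let θ' : B × (F →L[ℝ] ℝ) →L[ℝ] ℝ := θ
  obtain ⟨f, hf⟩ := exists_dTot_base (E := E) (F := F) q
    (θ'.comp (ContinuousLinearMap.inl ℝ B (F →L[ℝ] ℝ)))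
  -- The vertical part of the covector is an element of the bidual of `F`, hence evaluation at some
  -- `v`; the section extending `v` realises it.
  obtain ⟨v, hv⟩ := exists_vector_eq
    (θ'.comp (ContinuousLinearMap.inr ℝ B (F →L[ℝ] ℝ)) : (F →L[ℝ] ℝ) →ₗ[ℝ] ℝ)
  obtain ⟨σ, hσ⟩ := exists_dTot_hat (B := B) (E := E) q v
  refine ⟨f, σ, ContinuousLinearMap.ext fun w => ?_⟩
  change θ w = dTot B (fun b : DualTot F E => f b.1) ⟨q, a⟩ w + dTot B (hat σ) ⟨q, a⟩ w
  rw [hf, hσ, hv]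
  have h : θ' (show B × (F →L[ℝ] ℝ) from w) = θ' ((show B × (F →L[ℝ] ℝ) from w).1, 0) +
      θ' (0, (show B × (F →L[ℝ] ℝ) from w).2) := by
    rw [← map_add, Prod.mk_add_mk, add_zero, zero_add]; rfl
  exact h

/-- A map into `E*` is smooth if its composites with the projection and with the fibrewise linear
functions are smooth. -/
theorem contMDiffAt_dualTot [FiniteDimensional ℝ F] {W H M : Type*} [NormedAddCommGroup W]
    [NormedSpace ℝ W] [TopologicalSpace H] {I : ModelWithCorners ℝ W H} [TopologicalSpace M]
    [ChartedSpace H M] {g : M → DualTot F E} {x : M}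
    (h : ContMDiffAt I 𝓘(ℝ, B) ∞ (fun y => (g y).1) x)
    (h' : ∀ σ : Sec B F E, ContMDiffAt I 𝓘(ℝ) ∞ (fun y => hat σ (g y)) x) :
    ContMDiffAt I (𝓘(ℝ, B).prod 𝓘(ℝ, F →L[ℝ] ℝ)) ∞ g x := by
  rw [contMDiffAt_totalSpace]
  refine ⟨h, contMDiffAt_clm_of_apply fun v => ?_⟩
  -- Near `x`, the fibre coordinate of `g` in the direction `v` is `hat σ ∘ g` for a section `σ`
  -- that is constant, equal to `v`, in the trivialisation.
  obtain ⟨σ, hσ⟩ := exists_eventually_eq_symmL B F E (g x).1 v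
  refine (h' σ).congr_of_eventuallyEq ?_
  filter_upwards [h.continuousAt.eventually hσ] with y hy
  rw [dual_trivializationAt_apply, ← hy]
  rfl

variable (B F E) in
/-- Local frames of `E` and `E*` which are dual to each other. -/
theorem exists_dual_frames [FiniteDimensional ℝ F] (q : Q) :
    ∃ (e : Fin (finrank ℝ F) → Sec B F E) (ε : Fin (finrank ℝ F) → DualSec B F E),
      ∀ᶠ x in 𝓝 q, ∀ a : E x →L[ℝ] ℝ, a = ∑ i, a (e i x) • ε i x := by
  let b := Module.finBasis ℝ F
  choose e he using fun i => exists_eventually_eq_symmL B F E q (b i)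
  choose ε hε using fun i => exists_eventually_eq_symmL B (F →L[ℝ] ℝ) (fun q => E q →L[ℝ] ℝ) q
    (b.coord i).toContinuousLinearMap
  refine ⟨e, ε, ?_⟩
  filter_upwards [Filter.eventually_all.2 he, Filter.eventually_all.2 hε,
    (trivializationAt F E q).open_baseSet.mem_nhds (FiberBundle.mem_baseSet_trivializationAt' q),
    (trivializationAt (F →L[ℝ] ℝ) (fun q => E q →L[ℝ] ℝ) q).open_baseSet.mem_nhds
      (FiberBundle.mem_baseSet_trivializationAt' q)] with x h1 h2 h3 h4 a
  set t := trivializationAt F E q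
  set t' := trivializationAt (F →L[ℝ] ℝ) (fun q => E q →L[ℝ] ℝ) q
  have h5 : ∀ a : E x →L[ℝ] ℝ, t'.continuousLinearMapAt ℝ x a =
      a.comp (t.symmL ℝ x) := by
    intro a
    rw [Trivialization.continuousLinearMapAt_apply, Trivialization.linearMapAt_apply, if_pos h4]
    ext v
    exact dual_trivializationAt_apply q ⟨x, a⟩ v
  -- The identity is checked in the typical fibre, where it is the expansion of a functional in the
  -- basis dual to `b`. The trivialisation is injective on the fibre over `x`.
  have h6 : t'.continuousLinearMapAt ℝ x a =
      t'.continuousLinearMapAt ℝ x (∑ i, a (e i x) • ε i x) := by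
    rw [map_sum]
    have h7 : ∀ i, t'.continuousLinearMapAt ℝ x (a (e i x) • ε i x) =
        a (e i x) • (b.coord i).toContinuousLinearMap := fun i => by
      rw [map_smul, h2, Trivialization.continuousLinearMapAt_symmL _ h4]
    rw [Finset.sum_congr rfl fun i _ => h7 i, h5]
    refine ContinuousLinearMap.coe_injective (b.ext fun j => ?_)
    simp [h1, Finsupp.single_apply, t]
  have h7 := congrArg (t'.symmL ℝ x) h6
  rwa [t'.symmL_continuousLinearMapAt h4, t'.symmL_continuousLinearMapAt h4] at h7

end duals

end HJ

namespace HJ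
noncomputable section

/-! ### Derivatives along the fibres and along sections of the dual bundle -/

section curves
variable {B : Type*} [NormedAddCommGroup B] [NormedSpace ℝ B]
  {Q : Type*} [TopologicalSpace Q] [ChartedSpace B Q]
  {F : Type*} [NormedAddCommGroup F] [NormedSpace ℝ F]
  {E : Q → Type*} [TopologicalSpace (TotalSpace F E)] [∀ q, AddCommGroup (E q)]
  [∀ q, Module ℝ (E q)] [∀ q, TopologicalSpace (E q)]
  [FiberBundle F E] [VectorBundle ℝ F E]
  [FiniteDimensional ℝ F] [ContMDiffVectorBundle ∞ F E 𝓘(ℝ, B)]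

/-- The vertical lift of a covector. -/
theorem exists_verticalLift (q : Q) (a b : E q →L[ℝ] ℝ) :
    ∃ w : DualTangent B (⟨q, a⟩ : DualTot F E), ∀ G : DualTot F E → ℝ,
      MDifferentiableAt (𝓘(ℝ, B).prod 𝓘(ℝ, F →L[ℝ] ℝ)) 𝓘(ℝ) G ⟨q, a⟩ →
        HasDerivAt (fun t : ℝ => G ⟨q, a + t • b⟩) (dTot B G ⟨q, a⟩ w) 0 := by
  set t := trivializationAt (F →L[ℝ] ℝ) (fun q => E q →L[ℝ] ℝ) q with ht
  have hq : q ∈ t.baseSet := FiberBundle.mem_baseSet_trivializationAt' q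
  let g : ℝ → (F →L[ℝ] ℝ) := fun r =>
    t.continuousLinearMapAt ℝ q a + r • t.continuousLinearMapAt ℝ q b
  have hg : MDifferentiableAt 𝓘(ℝ) 𝓘(ℝ, F →L[ℝ] ℝ) g 0 := by
    refine DifferentiableAt.mdifferentiableAt ?_
    fun_prop
  let k : ℝ → DualTot F E := fun r => ⟨q, a + r • b⟩
  -- In a trivialisation the line `a + r • b` is an affine curve in the typical fibre, hence
  -- differentiable; the vertical lift is its velocity at `0`.
  have hk : k = fibreMap q ∘ g := by
    funext r
    change (⟨q, a + r • b⟩ : DualTot F E) = ⟨q, t.symmL ℝ q (g r)⟩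
    simp only [g, map_add, map_smul]
    rw [t.symmL_continuousLinearMapAt hq, t.symmL_continuousLinearMapAt hq]
  have hk0 : k 0 = ⟨q, a⟩ := by simp [k]
  have hkd : MDifferentiableAt 𝓘(ℝ) (𝓘(ℝ, B).prod 𝓘(ℝ, F →L[ℝ] ℝ)) k 0 := by
    rw [hk]
    exact ((contMDiff_fibreMap (B := B) (E := E) q).mdifferentiable (by simp) _).comp _ hg
  refine ⟨mfderiv 𝓘(ℝ) (𝓘(ℝ, B).prod 𝓘(ℝ, F →L[ℝ] ℝ)) k 0 (1 : ℝ), fun G hG => ?_⟩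
  have h1 := mfderiv_comp_apply_of_eq (0 : ℝ) hG hkd hk0 (1 : ℝ)
  have h2 : MDifferentiableAt 𝓘(ℝ) 𝓘(ℝ) (G ∘ k) 0 := by
    rw [← hk0] at hG
    exact hG.comp 0 hkd
  have h3 : DifferentiableAt ℝ (G ∘ k) 0 := mdifferentiableAt_iff_differentiableAt.1 h2
  have h4 := h3.hasDerivAt
  rw [mfderiv_eq_fderiv] at h1
  exact h4.congr_deriv h1

theorem mdifferentiable_dualSec (β : DualSec B F E) : MDifferentiable 𝓘(ℝ, B)
    (𝓘(ℝ, B).prod 𝓘(ℝ, F →L[ℝ] ℝ)) (fun x => (⟨x, β x⟩ : DualTot F E)) :=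
  β.contMDiff.mdifferentiable (by simp)

/-- The chain rule for the composite of a function on `E*` with a section. -/
theorem dTot_mfderiv_dualSec (β : DualSec B F E) (q : Q) {G : DualTot F E → ℝ}
    (hG : MDifferentiableAt (𝓘(ℝ, B).prod 𝓘(ℝ, F →L[ℝ] ℝ)) 𝓘(ℝ) G ⟨q, β q⟩)
    (u : TangentSpace 𝓘(ℝ, B) q) :
    dTot B G ⟨q, β q⟩ (mfderiv 𝓘(ℝ, B) (𝓘(ℝ, B).prod 𝓘(ℝ, F →L[ℝ] ℝ))
      (fun x => (⟨x, β x⟩ : DualTot F E)) q u) = dirDeriv B u (fun x => G ⟨x, β x⟩) :=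
  (mfderiv_comp_apply (f := fun x => (⟨x, β x⟩ : DualTot F E)) q hG
    (mdifferentiable_dualSec β q) u).symm

theorem mdifferentiable_hat (σ : Sec B F E) : MDifferentiable
    (𝓘(ℝ, B).prod 𝓘(ℝ, F →L[ℝ] ℝ)) 𝓘(ℝ) (hat σ : DualTot F E → ℝ) :=
  (contMDiff_hat σ).mdifferentiable (by simp)

theorem mdifferentiable_base (f : C^∞⟮𝓘(ℝ, B), Q; 𝓘(ℝ), ℝ⟯) : MDifferentiable
    (𝓘(ℝ, B).prod 𝓘(ℝ, F →L[ℝ] ℝ)) 𝓘(ℝ) (fun b : DualTot F E => f b.1) :=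
  fun a => (f.contMDiff.comp (contMDiff_proj _)).mdifferentiable (by simp) a

end curves

/-! ### Smoothness of `H` and `F_h`, and the differential of `F_h` along `h ∘ α` -/

namespace MechanicalSystem
open NowhereZero
variable {B : Type*} [NormedAddCommGroup B] [NormedSpace ℝ B]
  {Q : Type*} [TopologicalSpace Q] [ChartedSpace B Q]
  {F : Type*} [NormedAddCommGroup F] [NormedSpace ℝ F]
  {E : Q → Type*} [TopologicalSpace (TotalSpace F E)] [∀ q, AddCommGroup (E q)]
  [∀ q, Module ℝ (E q)] [∀ q, TopologicalSpace (E q)]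
  [FiberBundle F E] [VectorBundle ℝ F E]
  [FiniteDimensional ℝ F] [ContMDiffVectorBundle ∞ F E 𝓘(ℝ, B)]
  [FiniteDimensional ℝ B] [T2Space Q] [IsManifold 𝓘(ℝ, B) ∞ Q]
  (S : MechanicalSystem B F E) (α : DualSec B (KerModel F) S.φ.Ker)

/-- `μ` covers the identity of `Q` and pulls fibrewise linear functions on `V*` back to fibrewise
linear functions on `E*`. -/
theorem contMDiff_μ : ContMDiff (𝓘(ℝ, B).prod 𝓘(ℝ, F →L[ℝ] ℝ))
    (𝓘(ℝ, B).prod 𝓘(ℝ, KerModel F →L[ℝ] ℝ)) ∞ S.μ := fun a =>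
  contMDiffAt_dualTot (contMDiffAt_proj _) fun σ => contMDiff_hat (S.φ.inclSec σ) a

theorem mdifferentiable_μ : MDifferentiable (𝓘(ℝ, B).prod 𝓘(ℝ, F →L[ℝ] ℝ))
    (𝓘(ℝ, B).prod 𝓘(ℝ, KerModel F →L[ℝ] ℝ)) S.μ :=
  S.contMDiff_μ.mdifferentiable (by simp)

/-- In dual local frames `e i`, `ε i` of `V` and `V*`, the quadratic form `G*_V(η, η)` is the sum of
the products `η(e i) η(♯ε i)`, with `♯` the inverse of `kerFlat`. The sections `♯ε i` are smooth
because they are the sections `ζ` attached to `ε i`. -/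
theorem contMDiff_hamiltonianFunction :
    ContMDiff (𝓘(ℝ, B).prod 𝓘(ℝ, KerModel F →L[ℝ] ℝ)) 𝓘(ℝ) ∞ S.H := by
  intro η
  obtain ⟨e, ε, h⟩ := exists_dual_frames B (KerModel F) S.φ.Ker η.1
  have h1 : ContMDiffAt (𝓘(ℝ, B).prod 𝓘(ℝ, KerModel F →L[ℝ] ℝ)) 𝓘(ℝ) ∞ (fun η : S.VDual =>
      1 / 2 * (∑ i, hat (e i) η * hat (S.zeta (ε i)) η) + S.potential η.1) η := by
    refine (contMDiffAt_const.mul (ContMDiffAt.sum fun i _ =>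
      (contMDiff_hat (e i) η).mul (contMDiff_hat (S.zeta (ε i)) η))).add ?_
    exact (S.potential.contMDiff η.1).comp η (contMDiffAt_proj _)
  refine h1.congr_of_eventuallyEq ?_
  filter_upwards [eventually_proj (a := (η : DualTot (KerModel F) S.φ.Ker)) h] with η' h'
  have h2 : ∀ i, S.zeta (ε i) η'.1 = (S.kerFlat η'.1).symm (ε i η'.1) := fun i =>
    (S.exists_zeta (ε i)).choose_spec.1 η'.1
  have h3 : S.cometric η'.1 η'.2 η'.2 = ∑ i, hat (e i) η' * hat (S.zeta (ε i)) η' := by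
    have h4 : S.cometric η'.1 η'.2 η'.2 = η'.2 ((S.kerFlat η'.1).symm η'.2) := by
      rw [cometric, ← kerFlat_apply, LinearEquiv.apply_symm_apply]
    have h5 : (S.kerFlat η'.1).symm η'.2 =
        ∑ i, η'.2 (e i η'.1) • S.zeta (ε i) η'.1 := by
      conv_lhs => rw [h' η'.2]
      rw [map_sum]
      exact Finset.sum_congr rfl fun i _ => by rw [map_smul, h2]
    rw [h4, h5, map_sum]
    exact Finset.sum_congr rfl fun i _ => by rw [map_smul]; rfl
  rw [H, h3]

theorem mdifferentiable_Fh : MDifferentiable (𝓘(ℝ, B).prod 𝓘(ℝ, F →L[ℝ] ℝ)) 𝓘(ℝ) S.Fh := by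
  have h : ContMDiff (𝓘(ℝ, B).prod 𝓘(ℝ, F →L[ℝ] ℝ)) 𝓘(ℝ) ∞ S.Fh :=
    (contMDiff_hat S.X).add (S.contMDiff_hamiltonianFunction.comp S.contMDiff_μ)
  exact h.mdifferentiable (by simp)

/-- `h(η)` takes the value `-H(η)` on `𝒳` and is mapped to `η` by `μ`, so the two terms of `F_h`
cancel. -/
theorem Fh_h (η : S.VDual) : S.Fh (S.h η) = 0 := by
  have h1 : (S.h η).2 (S.X η.1) = - S.H η := S.h_X η
  change (S.h η).2 (S.X η.1) + S.H (S.μ (S.h η)) = 0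
  rw [h1, μ_h]
  ring

/-- On a fibre, `F_h` is evaluation at `𝒳` plus `H ∘ μ`. The first term is linear and contributes
`𝒳`; by the definition of `ζ_H^α`, the second contributes `ζ_H^α`. -/
theorem hasDerivAt_Fh (q : Q) (b : E q →L[ℝ] ℝ) :
    HasDerivAt (fun t : ℝ => S.Fh ⟨q, S.hSec α q + t • b⟩)
      (b ((S.X + S.φ.inclSec (S.zeta α)) q)) 0 := by
  have h1 : ∀ t : ℝ, S.Fh ⟨q, S.hSec α q + t • b⟩ =
      (S.hSec α q (S.X q) + t * b (S.X q)) + S.H ⟨q, α q + t • b.comp (S.φ.incl q)⟩ := by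
    intro t
    have h2 : S.μ ⟨q, S.hSec α q + t • b⟩ = ⟨q, α q + t • b.comp (S.φ.incl q)⟩ := by
      change (⟨q, (S.hSec α q + t • b).comp (S.φ.incl q)⟩ : S.VDual) = _
      congr 1
      ext v
      have h3 : S.hSec α q (S.φ.incl q v) = α q v := S.h_incl ⟨q, α q⟩ v
      change S.hSec α q (S.φ.incl q v) + t * b (S.φ.incl q v) = α q v + t * b (S.φ.incl q v)
      rw [h3]
    change (S.hSec α q + t • b) (S.X q) + S.H (S.μ ⟨q, S.hSec α q + t • b⟩) = _
    rw [h2]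
    rfl
  have h3 := (((hasDerivAt_id (0 : ℝ)).mul_const (b (S.X q))).const_add (S.hSec α q (S.X q))).add
    (S.hasDerivAt_zeta α q (b.comp (S.φ.incl q)))
  have h4 : b ((S.X + S.φ.inclSec (S.zeta α)) q) =
      1 * b (S.X q) + b.comp (S.φ.incl q) (S.zeta α q) := by
    rw [one_mul]
    exact map_add b (S.X q) (S.φ.incl q (S.zeta α q))
  rw [h4, funext h1]
  exact h3

/-- Along the image of `h ∘ α`, the differential of `F_h` is that of the sum of a function on the
base and a fibrewise linear function. -/
theorem exists_dTot_Fh (q : Q) : ∃ (f : C^∞⟮𝓘(ℝ, B), Q; 𝓘(ℝ), ℝ⟯) (σ : Sec B F E),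
    dTot B S.Fh ⟨q, S.hSec α q⟩ = dTot B (fun b : DualTot F E => f b.1) ⟨q, S.hSec α q⟩ +
      dTot B (hat σ) ⟨q, S.hSec α q⟩ ∧
    σ q = (S.X + S.φ.inclSec (S.zeta α)) q ∧
    ∀ u : TangentSpace 𝓘(ℝ, B) q, dirDeriv B u f = - dirDeriv B u (fun x => S.hSec α x (σ x)) := by
  obtain ⟨f, σ, h⟩ := exists_covector_eq (B := B) (⟨q, S.hSec α q⟩ : DualTot F E)
    (dTot B S.Fh ⟨q, S.hSec α q⟩)
  refine ⟨f, σ, h, ?_, fun u => ?_⟩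
  · have := FiberBundle.t2Space F E q
    have := VectorBundle.finiteDimensional ℝ F E q
    have := (VectorBundle.continuousLinearEquivAt ℝ F E
      q).toContinuousAddEquiv.isTopologicalAddGroup
    have := (VectorBundle.continuousLinearEquivAt ℝ F E q).continuousSMul
    have h1 : ∀ b : E q →L[ℝ] ℝ, b (σ q) = b ((S.X + S.φ.inclSec (S.zeta α)) q) := by
      intro b
      -- Pairing the decomposition of `dF_h` with the vertical lift of `b` kills the basic term and
      -- leaves `b(σ(q))`.
      obtain ⟨w, hw⟩ := exists_verticalLift (B := B) (F := F) q (S.hSec α q) b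
      have h2 := (hw _ (S.mdifferentiable_Fh _)).unique (S.hasDerivAt_Fh α q b)
      have h3 := (hw _ (mdifferentiable_base f _)).unique (hasDerivAt_const (0 : ℝ) (f q))
      have h4 : HasDerivAt (fun t : ℝ => (hat σ : DualTot F E → ℝ) ⟨q, S.hSec α q + t • b⟩)
          (1 * b (σ q)) 0 :=
        ((hasDerivAt_id (0 : ℝ)).mul_const (b (σ q))).const_add (S.hSec α q (σ q))
      have h5 := (hw _ (mdifferentiable_hat σ _)).unique h4
      have h6 := congrArg (fun θ => θ w) h
      simp only [add_apply] at h6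
      rw [h2, h3, h5] at h6
      linarith
    have h2 : ∀ g : Module.Dual ℝ (E q), g (σ q) = g ((S.X + S.φ.inclSec (S.zeta α)) q) :=
      fun g => h1 (LinearMap.toContinuousLinearMap g)
    rw [← sub_eq_zero, ← Module.forall_dual_apply_eq_zero_iff ℝ]
    intro g
    rw [map_sub, h2, sub_self]
  -- Pairing with the image of `u` under the derivative of `h ∘ α` gives zero on the left, since
  -- `F_h` vanishes identically along that section.
  · have h1 := dTot_mfderiv_dualSec (S.hSec α) q (S.mdifferentiable_Fh _) u
    have h2 := dTot_mfderiv_dualSec (S.hSec α) q (mdifferentiable_base f _) u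
    have h3 := dTot_mfderiv_dualSec (S.hSec α) q (mdifferentiable_hat σ _) u
    have h4 : (fun x => S.Fh ⟨x, S.hSec α x⟩) = fun _ => (0 : ℝ) :=
      funext fun x => S.Fh_h ⟨x, α x⟩
    rw [h4, dirDeriv_const, h] at h1
    have h5 : dirDeriv B u f + dirDeriv B u (fun x => S.hSec α x (σ x)) = 0 := by
      rw [← h1]
      exact (congrArg₂ (· + ·) h2 h3).symm
    linarith

/-! ### The action of `R_h` on basic and fibrewise linear functions -/

/-- The section `𝒳 + ζ_H^α`, whose image under the anchor is `R_h^α`. -/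
def velocity : Sec B F E := S.X + S.φ.inclSec (S.zeta α)

/-- The chain rule through `μ` at `h(α(q))`, which `μ` sends back to `α(q)`. It reduces every
computation with `R_h` to the bracket with `F_h` on `E*`. -/
theorem dTot_R (q : Q) {G : S.VDual → ℝ}
    (hG : MDifferentiableAt (𝓘(ℝ, B).prod 𝓘(ℝ, KerModel F →L[ℝ] ℝ)) 𝓘(ℝ) G ⟨q, α q⟩) :
    dTot B (F := KerModel F) (E := S.φ.Ker) G ⟨q, α q⟩ (S.R ⟨q, α q⟩) =
      S.algebroid.bivector ⟨q, S.hSec α q⟩ (dTot B (G ∘ S.μ) ⟨q, S.hSec α q⟩)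
        (dTot B S.Fh ⟨q, S.hSec α q⟩) := by
  rw [← S.algebroid.apply_hamiltonian]
  have h := S.μ_h ⟨q, α q⟩
  exact (mfderiv_comp_apply_of_eq (S.h ⟨q, α q⟩) hG (S.mdifferentiable_μ _) h _).symm

/-- Basic functions commute, so only the fibrewise linear part `σ̂` of `dF_h` contributes, and it
does so through the value `σ(q) = 𝒳(q) + ζ_H^α(q)` alone. -/
theorem dTot_base_R (q : Q) (f : C^∞⟮𝓘(ℝ, B), Q; 𝓘(ℝ), ℝ⟯) :
    dTot B (fun η : DualTot (KerModel F) S.φ.Ker => f η.1) ⟨q, α q⟩ (S.R ⟨q, α q⟩) =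
      dirDeriv B (S.algebroid.anchor q (S.velocity α q)) f := by
  obtain ⟨g, σ, h1, h2, h3⟩ := S.exists_dTot_Fh α q
  have hP := S.algebroid.isLinearBivectorAt_bivector ⟨q, S.hSec α q⟩
  rw [S.dTot_R α q (mdifferentiable_base (E := S.φ.Ker) (F := KerModel F) f _), h1, map_add]
  have h4 := hP.base_base f g
  have h5 := hP.base_hat f σ
  rw [h2] at h5
  exact (congrArg₂ (· + ·) h4 h5).trans (zero_add _)

theorem Rα_eq (q : Q) : S.Rα α q = S.algebroid.anchor q (S.velocity α q) := by
  refine tangent_ext fun f => ?_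
  rw [← S.dTot_base_R α q f]
  have hf : MDifferentiableAt 𝓘(ℝ, B) 𝓘(ℝ) f q := f.contMDiff.mdifferentiable (by simp) q
  have hp : MDifferentiableAt (𝓘(ℝ, B).prod 𝓘(ℝ, KerModel F →L[ℝ] ℝ)) 𝓘(ℝ, B)
      (fun η : S.VDual => η.1) ⟨q, α q⟩ :=
    (contMDiff_proj (fun q => S.φ.Ker q →L[ℝ] ℝ) (n := ∞)).mdifferentiable (by simp) _
  exact (mfderiv_comp_apply (f := fun η : S.VDual => η.1) (⟨q, α q⟩ : S.VDual) hf hp _).symm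

/-- This is the central computation: the last term measures how far `R_h` is from being tangent to
the image of `α`. It comes from `{γ̂, f ∘ τ} + {γ̂, σ̂}` by replacing `df` with `-d((h ∘ α)(σ))` and
recognising the definition of `d^E`. -/
theorem dTot_hat_R (q : Q) (γ : Sec B (KerModel F) S.φ.Ker) :
    dTot B (hat γ) ⟨q, α q⟩ (S.R ⟨q, α q⟩) =
      dirDeriv B (S.Rα α q) (fun x => α x (γ x)) -
        S.algebroid.d (S.hSec α) (S.velocity α) (S.φ.inclSec γ) q := by
  obtain ⟨g, σ, h1, h2, h3⟩ := S.exists_dTot_Fh α q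
  have hP := S.algebroid.isLinearBivectorAt_bivector ⟨q, S.hSec α q⟩
  rw [S.dTot_R α q (mdifferentiable_hat γ _), h1, map_add]
  have h4 := hP.base_hat g (S.φ.inclSec γ)
  rw [hP.skew, h3] at h4
  have h5 := hP.hat_hat (S.φ.inclSec γ) σ
  have h6 : (fun x => S.hSec α x (S.φ.inclSec γ x)) = fun x => α x (γ x) :=
    funext fun x => S.h_incl ⟨x, α x⟩ (γ x)
  -- The section `σ` agrees with `𝒳 + ζ_H^α` only at `q`; tensoriality of `d^E(h ∘ α)` allows the
  -- exchange although brackets and derivatives occur in it.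
  rw [S.algebroid.d_congr (S.hSec α) (σ := S.velocity α) (σ' := σ) (γ := S.φ.inclSec γ)
    (γ' := S.φ.inclSec γ) h2.symm rfl, Rα_eq, velocity, ← h2, SkewAlgebroid.d, h6]
  have h7 : hat (S.algebroid.bracket (S.φ.inclSec γ) σ) (⟨q, S.hSec α q⟩ : DualTot F E) =
      - S.hSec α q (S.algebroid.bracket σ (S.φ.inclSec γ) q) := by
    rw [S.algebroid.skew]
    exact map_neg (S.hSec α q) _
  rw [h7] at h5
  refine (congrArg₂ (· + ·) (neg_eq_iff_eq_neg.1 h4) h5).trans ?_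
  ring

/-- On sections of `V`, the differential of `h ∘ α` is that of `α`: `h ∘ α` restricts to `α`, and
the bracket and anchor of `V` are restrictions. The `𝒳` term is the one not seen by `V`. -/
theorem d_velocity (γ : Sec B (KerModel F) S.φ.Ker) (q : Q) :
    S.algebroid.d (S.hSec α) (S.velocity α) (S.φ.inclSec γ) q =
      S.kerAlgebroid.d α (S.zeta α) γ q +
        S.algebroid.d (S.hSec α) S.X (S.φ.inclSec γ) q := by
  have h1 : ∀ σ : Sec B (KerModel F) S.φ.Ker,
      (fun x => S.hSec α x (S.φ.inclSec σ x)) = fun x => α x (σ x) := fun σ =>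
    funext fun x => S.h_incl ⟨x, α x⟩ (σ x)
  have h2 : S.algebroid.d (S.hSec α) (S.φ.inclSec (S.zeta α)) (S.φ.inclSec γ) q =
      S.kerAlgebroid.d α (S.zeta α) γ q := by
    rw [SkewAlgebroid.d, SkewAlgebroid.d, h1, h1]
    have h3 : S.hSec α q (S.algebroid.bracket (S.φ.inclSec (S.zeta α)) (S.φ.inclSec γ) q) =
        α q (S.kerAlgebroid.bracket (S.zeta α) γ q) :=
      S.h_incl ⟨q, α q⟩ (S.kerAlgebroid.bracket (S.zeta α) γ q)
    rw [h3]
    rfl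
  -- Additivity is stated in the second argument, so skew-symmetry moves the sum there and back.
  rw [← h2, S.algebroid.d_skew, velocity, SkewAlgebroid.d_add, S.algebroid.d_skew _ _ S.X,
    S.algebroid.d_skew _ (S.φ.inclSec γ)]
  ring

/-! ### Relatedness, the Hamilton–Jacobi equation and integral curves -/

/-- The vector fields `R_h^α` and `R_h` are `α`-related if and only if the Hamilton–Jacobi equation
holds. -/
theorem mfderiv_Rα_eq_iff (q : Q) :
    mfderiv 𝓘(ℝ, B) (𝓘(ℝ, B).prod 𝓘(ℝ, KerModel F →L[ℝ] ℝ))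
      (fun x => (⟨x, α x⟩ : S.VDual)) q (S.Rα α q) = S.R ⟨q, α q⟩ ↔
    ∀ γ : Sec B (KerModel F) S.φ.Ker,
      S.algebroid.d (S.hSec α) (S.velocity α) (S.φ.inclSec γ) q = 0 := by
  have h1 : ∀ γ : Sec B (KerModel F) S.φ.Ker, dTot B (hat γ) ⟨q, α q⟩
      (mfderiv 𝓘(ℝ, B) (𝓘(ℝ, B).prod 𝓘(ℝ, KerModel F →L[ℝ] ℝ))
      (fun x => (⟨x, α x⟩ : S.VDual)) q (S.Rα α q)) =
      dirDeriv B (S.Rα α q) (fun x => α x (γ x)) := fun γ =>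
    dTot_mfderiv_dualSec α q (mdifferentiable_hat γ _) _
  constructor
  · intro h γ
    have h2 := h1 γ
    rw [h, dTot_hat_R] at h2
    linarith
  · intro h
    refine dualTangent_ext (E := S.φ.Ker) (fun f => ?_) fun γ => ?_
    -- Basic functions impose no condition: both vectors project to `R_h^α(q)`.
    · rw [dTot_base_R, ← Rα_eq]
      exact dTot_mfderiv_dualSec α q (mdifferentiable_base f _) _
    · rw [h1, dTot_hat_R, h, sub_zero]

/-- Being the anchor applied to a smooth section, `R_h^α` is smooth, and the Picard–Lindelöf theorem
applies on the boundaryless manifold `Q`. -/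
theorem exists_isMIntegralCurveAt_Rα (q : Q) :
    ∃ c : ℝ → Q, c 0 = q ∧ IsMIntegralCurveAt (I := 𝓘(ℝ, B)) c (S.Rα α) 0 := by
  have : CompleteSpace B := FiniteDimensional.complete ℝ B
  refine exists_isMIntegralCurveAt_of_contMDiffAt_boundaryless 0 ?_
  rw [funext (S.Rα_eq α)]
  have h := (S.algebroid.anchor.contMDiff q).clm_bundle_apply ((S.velocity α).contMDiff q)
  exact h.of_le (by simp)

end MechanicalSystem

end
end HJ

/-- The equation between sections of `V*` is tested on sections `γ` of `V`. This is the pointwise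
equation, since both terms are tensorial in `γ` and every vector of `V` extends to a section. -/
theorem corollary4p4 {B : Type*} [NormedAddCommGroup B] [NormedSpace ℝ B] [FiniteDimensional ℝ B]
    {Q : Type*} [TopologicalSpace Q] [T2Space Q] [ChartedSpace B Q] [IsManifold 𝓘(ℝ, B) ∞ Q]
    {F : Type*} [NormedAddCommGroup F] [NormedSpace ℝ F] [FiniteDimensional ℝ F]
    {E : Q → Type*} [TopologicalSpace (TotalSpace F E)] [∀ q, AddCommGroup (E q)]
    [∀ q, Module ℝ (E q)] [∀ q, TopologicalSpace (E q)] [FiberBundle F E] [VectorBundle ℝ F E]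
    [ContMDiffVectorBundle ∞ F E 𝓘(ℝ, B)]
    (S : HJ.MechanicalSystem B F E)
    (α : HJ.DualSec B (HJ.NowhereZero.KerModel F) S.φ.Ker) :
    (∀ (I : Set ℝ) (c : ℝ → Q), IsOpen I → I.OrdConnected →
      IsMIntegralCurveOn (I := 𝓘(ℝ, B)) c (S.Rα α) I →
      IsMIntegralCurveOn (I := 𝓘(ℝ, B).prod 𝓘(ℝ, HJ.NowhereZero.KerModel F →L[ℝ] ℝ))
        (fun t => (⟨c t, α (c t)⟩ : S.VDual)) S.R I) ↔
    ∀ (γ : HJ.Sec B (HJ.NowhereZero.KerModel F) S.φ.Ker) (q : Q),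
      S.kerAlgebroid.d α (S.zeta α) γ q +
        S.algebroid.d (S.hSec α) S.X (S.φ.inclSec γ) q = 0 := by
  have hα := HJ.mdifferentiable_dualSec α
  constructor
  · intro h γ q
    rw [← S.d_velocity]
    refine (S.mfderiv_Rα_eq_iff α q).1 ?_ γ
    obtain ⟨c, rfl, hc⟩ := S.exists_isMIntegralCurveAt_Rα α q
    -- A ball in `ℝ` is an open interval, so the hypothesis on curves applies to the local integral
    -- curve.
    obtain ⟨r, hr, hcr⟩ := isMIntegralCurveAt_iff'.1 hc
    have h0 : Metric.ball (0 : ℝ) r ∈ 𝓝 (0 : ℝ) := Metric.ball_mem_nhds 0 hr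
    have h1 := (h _ c Metric.isOpen_ball (convex_ball (0 : ℝ) r).ordConnected hcr 0
      (Metric.mem_ball_self hr)).hasMFDerivAt h0
    have h2 := (hα (c 0)).hasMFDerivAt.comp (0 : ℝ) hc.hasMFDerivAt
    -- The derivative of `α ∘ c` at `0` is known both from the chain rule and from the integral
    -- curve property; evaluating both at `1` gives relatedness at `c 0`.
    have h3 : mfderiv 𝓘(ℝ, B) (𝓘(ℝ, B).prod 𝓘(ℝ, HJ.NowhereZero.KerModel F →L[ℝ] ℝ))
        (fun x => (⟨x, α x⟩ : S.VDual)) (c 0) ((1 : ℝ) • S.Rα α (c 0)) =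
        (1 : ℝ) • S.R ⟨c 0, α (c 0)⟩ :=
      congrArg (fun L => L (1 : ℝ)) (hasMFDerivAt_unique h2 h1)
    rwa [one_smul, one_smul] at h3
  · intro h I c hI _ hc t ht
    have h1 := (hα (c t)).hasMFDerivAt.comp_hasMFDerivWithinAt t (hc t ht)
    refine h1.congr_mfderiv ?_
    have h2 := (S.mfderiv_Rα_eq_iff α (c t)).2 fun γ => by rw [S.d_velocity]; exact h γ (c t)
    have h3 : mfderiv 𝓘(ℝ, B) (𝓘(ℝ, B).prod 𝓘(ℝ, HJ.NowhereZero.KerModel F →L[ℝ] ℝ))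
        (fun x => (⟨x, α x⟩ : S.VDual)) (c t) ((1 : ℝ) • S.Rα α (c t)) =
        (1 : ℝ) • S.R ⟨c t, α (c t)⟩ := by
      rwa [one_smul, one_smul]
    -- A linear map out of `ℝ` is determined by its value at `1`, where relatedness gives the
    -- equality.
    exact ContinuousLinearMap.ext_ring h3
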